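/- Let $M$ be a smooth 4-manifold and let $L=|\Lambda^4TM|^{1/4}$ be its density bundle. Let $c$ be a smooth conformal metric on $M$, that is, a metric on $TM$ with values in $L^2$, normalized by $|\det c|=1$, and let $J$ be a smooth almost complex structure on $M$ with $c(JX,JY)=c(X,Y)$. Orient $M$ by $J$ (frames $(u,Ju,v,Jv)$ are positive), and let $\omega_c=c(J\cdot,\cdot)$ be the conformal Kähler form, an $L^2$-valued 2-form. Let $D$ be the canonical Weyl derivative of $(M,c,J)$, that is, the connection on $L$ with $d^D\omega_c=0$, and let $\nabla^D$ be its Weyl connection, that is, the torsion-free connection on $TM$ for which $c$ is parallel ($\nabla^D$ also denotes the connection induced by $\nabla^D$ and $D$ on $L^2$-valued forms). Let $\mathcal Z_+=S(L^2\Lambda^2_+T^*M)$ be the weightless twistor space: the bundle whose fibre at $p$ consists of the self-dual $L^2$-valued 2-forms $\sigma$ at $p$ of norm $\sqrt2$ (in the norm for which the forms $e^i\wedge e^j$, $i<j$, of a $c$-orthonormal coframe are orthonormal). Each $q=\sigma\in\mathcal Z_+$ over $p$ determines an endomorphism $J_q$ of $T_pM$ by $\sigma(X,Y)=c(J_qX,Y)$.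 The tangent space $T_q\mathcal Z_+$ consists of the vectors $X^h+\beta^v$, where $X\in T_pM$ and $\beta$ is an $L^2$-valued 2-form at $p$ with $\beta(J_qX,J_qY)=-\beta(X,Y)$; here $\beta^v=\frac{d}{dt}\big|_{t=0}(\sigma+t\beta)$, and $X^h=ds(X)-(\nabla^D_Xs)^v$ for a local section $s$ with $s(p)=q$. The almost complex structure $\mathcal J_+$ is given by $\mathcal J_+(X^h+\beta^v)=(J_qX)^h+(J_q\beta)^v$ with $(J_q\beta)(X,Y)=\beta(J_qX,Y)$. Then $\omega_c$ defines a smooth global section $s:M\to\mathcal Z_+$, and this section is $\mathcal J_+$-holomorphic: for all $p\in M$ and $Z\in T_pM$ one has $ds(Z)\in T_{s(p)}\mathcal Z_+$ and $$ds(JZ)=\mathcal J_+\,ds(Z).$$ Moreover $\nabla^D_{JZ}\omega_c=J(\nabla^D_Z\omega_c)$, that is, $(\nabla^D_{JZ}\omega_c)(X,Y)=(\nabla^D_Z\omega_c)(JX,Y)$ for all $X,Y,Z\in T_pM$. -/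

import Mathlib

open Bundle Set FiberBundle
open scoped Manifold ContDiff Topology

namespace WeylTwistor

noncomputable section

/-! ### Horizontal and vertical vectors in the total space of a vector bundle -/

section VectorBundleSplitting

variable {E : Type*} [NormedAddCommGroup E] [NormedSpace ℝ E] [FiniteDimensional ℝ E]
  {H : Type*} [TopologicalSpace H] {I : ModelWithCorners ℝ E H}
  {M : Type*} [TopologicalSpace M] [ChartedSpace H M]
  {F : Type*} [NormedAddCommGroup F] [NormedSpace ℝ F] [FiniteDimensional ℝ F]
  {V : M → Type*} [TopologicalSpace (TotalSpace F V)]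
  [∀ x, AddCommGroup (V x)] [∀ x, Module ℝ (V x)] [∀ x, TopologicalSpace (V x)]
  [FiberBundle F V] [VectorBundle ℝ F V] [IsManifold I 1 M] [ContMDiffVectorBundle 1 F V I]

variable (F) in
/-- The coordinate isomorphism of the fibre over `x` with the model fibre. -/
def fibreCoord (x : M) : V x ≃L[ℝ] F :=
  (trivializationAt F V x).continuousLinearEquivAt ℝ x (mem_baseSet_trivializationAt F V x)

theorem fibreCoord_apply (x : M) (β : V x) :
    fibreCoord F x β = (trivializationAt F V x ⟨x, β⟩).2 := by
  simp [fibreCoord]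

/-- The inclusion of the fibre over `x`, in coordinates, into the total space. -/
def fibreIncl (x : M) (f : F) : TotalSpace F V := ⟨x, (fibreCoord F x).symm f⟩

theorem trivializationAt_fibreIncl (x : M) (g : F) :
    (trivializationAt F V x (fibreIncl x g)).2 = g := by
  have h := fibreCoord_apply (F := F) (V := V) x ((fibreCoord (V := V) F x).symm g)
  rw [ContinuousLinearEquiv.apply_symm_apply] at h
  exact h.symm

variable (I)

theorem mdifferentiable_fibreIncl (x : M) :
    MDifferentiable 𝓘(ℝ, F) (I.prod 𝓘(ℝ, F)) (fibreIncl (F := F) (V := V) x) := by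
  intro f
  rw [mdifferentiableAt_totalSpace]
  refine ⟨mdifferentiableAt_const, ?_⟩
  have : (fun g => (trivializationAt F V (fibreIncl (F := F) (V := V) x f).proj
      (fibreIncl x g)).2) = fun g => g := funext fun g => trivializationAt_fibreIncl x g
  rw [this]
  exact mdifferentiableAt_id

variable {I}

/-- The line `t ↦ q + t β` in the fibre through `q`. -/
def fibreLine (q : TotalSpace F V) (β : V q.proj) (t : ℝ) : TotalSpace F V :=
  ⟨q.proj, q.2 + t • β⟩

variable (I) in
/-- The vertical vector `β^v = d/dt (q + t β)` at `t = 0`. -/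
def verticalVector (q : TotalSpace F V) (β : V q.proj) : TangentSpace (I.prod 𝓘(ℝ, F)) q :=
  mfderiv 𝓘(ℝ, ℝ) (I.prod 𝓘(ℝ, F)) (fibreLine q β) 0 (1 : ℝ)

theorem fibreLine_eq (q : TotalSpace F V) (β : V q.proj) :
    fibreLine q β = fibreIncl q.proj ∘
      fun t : ℝ => fibreCoord F q.proj q.2 + t • fibreCoord F q.proj β := by
  funext t
  simp [fibreLine, fibreIncl]

theorem fibreLine_zero (q : TotalSpace F V) (β : V q.proj) : fibreLine q β 0 = q := by
  simp [fibreLine]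

theorem mdifferentiable_fibreLine (q : TotalSpace F V) (β : V q.proj) :
    MDifferentiable 𝓘(ℝ, ℝ) (I.prod 𝓘(ℝ, F)) (fibreLine q β) := by
  rw [fibreLine_eq]
  refine (mdifferentiable_fibreIncl I q.proj).comp ?_
  rw [mdifferentiable_iff_differentiable]
  fun_prop

theorem verticalVector_eq (q : TotalSpace F V) (β : V q.proj) :
    verticalVector I q β = mfderiv 𝓘(ℝ, F) (I.prod 𝓘(ℝ, F)) (fibreIncl (F := F) (V := V) q.proj)
      (fibreCoord F q.proj q.2) (fibreCoord F q.proj β) := by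
  have h1 : HasDerivAt (fun t : ℝ => fibreCoord F q.proj q.2 + t • fibreCoord F q.proj β)
      (fibreCoord F q.proj β) 0 := by
    simpa using ((hasDerivAt_id (0 : ℝ)).smul_const (fibreCoord F q.proj β)).const_add
      (fibreCoord F q.proj q.2)
  have h2 := h1.hasFDerivAt.hasMFDerivAt
  have h4 : HasMFDerivAt 𝓘(ℝ, F) (I.prod 𝓘(ℝ, F)) (fibreIncl (F := F) (V := V) q.proj)
      (fibreCoord F q.proj q.2 + (0 : ℝ) • fibreCoord F q.proj β)
      (mfderiv 𝓘(ℝ, F) (I.prod 𝓘(ℝ, F)) (fibreIncl (F := F) (V := V) q.proj)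
        (fibreCoord F q.proj q.2)) := by
    rw [zero_smul, add_zero]
    exact (mdifferentiable_fibreIncl I q.proj (fibreCoord F q.proj q.2)).hasMFDerivAt
  have h3 := h4.comp (0 : ℝ) h2
  unfold verticalVector
  rw [fibreLine_eq, h3.mfderiv]
  exact congrArg (mfderiv 𝓘(ℝ, F) (I.prod 𝓘(ℝ, F)) (fibreIncl (F := F) (V := V) q.proj)
    (fibreCoord F q.proj q.2)) (one_smul ℝ (fibreCoord F q.proj β))

variable (I) in
/-- The vertical lift `β ↦ β^v`. -/
def verticalLift (q : TotalSpace F V) : V q.proj →ₗ[ℝ] TangentSpace (I.prod 𝓘(ℝ, F)) q where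
  toFun := verticalVector I q
  map_add' β β' := by
    rw [verticalVector_eq, verticalVector_eq, verticalVector_eq, map_add]
    exact (mfderiv 𝓘(ℝ, F) (I.prod 𝓘(ℝ, F)) (fibreIncl (F := F) (V := V) q.proj)
      (fibreCoord F q.proj q.2)).map_add _ _
  map_smul' a β := by
    rw [verticalVector_eq, verticalVector_eq, map_smul]
    exact (mfderiv 𝓘(ℝ, F) (I.prod 𝓘(ℝ, F)) (fibreIncl (F := F) (V := V) q.proj)
      (fibreCoord F q.proj q.2)).map_smul _ _

variable (nablaV : (σ : (x : M) → V x) → (x : M) → TangentSpace I x →ₗ[ℝ] V x)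

variable (I) in
/-- The differential at `π q` of a local section `s` of the bundle with `s(π q) = q`. -/
def extendDeriv (q : TotalSpace F V) :
    TangentSpace I q.proj →L[ℝ] TangentSpace (I.prod 𝓘(ℝ, F)) q :=
  mfderiv I (I.prod 𝓘(ℝ, F)) (fun y => TotalSpace.mk' F y (extend F q.2 y)) q.proj

/-- The horizontal lift `X^h = ds(X) - (∇_X s)^v` at `q`, where `s` is a local section of the
bundle with `s(π q) = q`. -/
def horizontalLift (q : TotalSpace F V) :
    TangentSpace I q.proj →ₗ[ℝ] TangentSpace (I.prod 𝓘(ℝ, F)) q :=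
  (extendDeriv I q).toLinearMap - verticalLift I q ∘ₗ nablaV (extend F q.2) q.proj

variable (I) in
/-- The differential of the bundle projection. -/
def projVec (q : TotalSpace F V) :
    TangentSpace (I.prod 𝓘(ℝ, F)) q →L[ℝ] TangentSpace I q.proj :=
  mfderiv (I.prod 𝓘(ℝ, F)) I (TotalSpace.proj : TotalSpace F V → M) q

theorem projVec_verticalLift (q : TotalSpace F V) (β : V q.proj) :
    projVec I q (verticalLift I q β) = 0 := by
  have h1 : HasMFDerivAt (I.prod 𝓘(ℝ, F)) I (TotalSpace.proj : TotalSpace F V → M)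
      (fibreLine q β 0) (projVec I q) := by
    rw [fibreLine_zero]; exact (mdifferentiable_proj V q).hasMFDerivAt
  have h2 := h1.comp (0 : ℝ) (mdifferentiable_fibreLine (I := I) q β 0).hasMFDerivAt
  have h3 : HasMFDerivAt 𝓘(ℝ, ℝ) I
      ((TotalSpace.proj : TotalSpace F V → M) ∘ fibreLine q β) (0 : ℝ) 0 :=
    hasMFDerivAt_const q.proj (0 : ℝ)
  exact congrArg (fun L => L (1 : ℝ)) (hasMFDerivAt_unique h2 h3)

theorem projVec_horizontalLift (q : TotalSpace F V) (X : TangentSpace I q.proj) :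
    projVec I q (horizontalLift nablaV q X) = X := by
  have hs : MDifferentiableAt I (I.prod 𝓘(ℝ, F))
      (fun y => TotalSpace.mk' F y (extend F q.2 y)) q.proj :=
    mdifferentiableAt_extend I F q.2
  have h1 : HasMFDerivAt (I.prod 𝓘(ℝ, F)) I (TotalSpace.proj : TotalSpace F V → M)
      (TotalSpace.mk' F q.proj (extend F q.2 q.proj)) (projVec I q) := by
    rw [extend_apply_self]; exact (mdifferentiable_proj V q).hasMFDerivAt
  have h2 := h1.comp q.proj hs.hasMFDerivAt
  have h3 : HasMFDerivAt I I ((TotalSpace.proj : TotalSpace F V → M) ∘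
      fun y => TotalSpace.mk' F y (extend F q.2 y)) q.proj
      (ContinuousLinearMap.id ℝ (TangentSpace I q.proj)) :=
    hasMFDerivAt_id q.proj
  have h4 := congrArg (fun L => L X) (hasMFDerivAt_unique h2 h3)
  simp only [horizontalLift, LinearMap.sub_apply, map_sub, LinearMap.comp_apply,
    projVec_verticalLift, sub_zero]
  exact h4

theorem verticalLift_injective (q : TotalSpace F V) :
    Function.Injective (verticalLift I q) := by
  rw [injective_iff_map_eq_zero]
  intro β hβ
  have hΦ : MDifferentiableAt (I.prod 𝓘(ℝ, F)) 𝓘(ℝ, F)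
      (fun z : TotalSpace F V => (trivializationAt F V q.proj z).2)
      (fibreIncl q.proj (fibreCoord F q.proj q.2)) :=
    ((mdifferentiableAt_totalSpace I (fun z : TotalSpace F V => z)
      (x₀ := fibreIncl q.proj (fibreCoord F q.proj q.2))).1 mdifferentiableAt_id).2
  have h2 := hΦ.hasMFDerivAt.comp (fibreCoord F q.proj q.2)
    (mdifferentiable_fibreIncl I q.proj (fibreCoord F q.proj q.2)).hasMFDerivAt
  have h3 : HasMFDerivAt 𝓘(ℝ, F) 𝓘(ℝ, F)
      ((fun z : TotalSpace F V => (trivializationAt F V q.proj z).2) ∘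
        fibreIncl q.proj) (fibreCoord F q.proj q.2) (ContinuousLinearMap.id ℝ F) := by
    have : ((fun z : TotalSpace F V => (trivializationAt F V q.proj z).2) ∘
        fibreIncl q.proj) = id := funext fun g => trivializationAt_fibreIncl q.proj g
    rw [this]
    exact hasMFDerivAt_id _
  have h4 := congrArg (fun L => L (fibreCoord F q.proj β)) (hasMFDerivAt_unique h2 h3)
  have h5 : mfderiv 𝓘(ℝ, F) (I.prod 𝓘(ℝ, F)) (fibreIncl (F := F) (V := V) q.proj)
      (fibreCoord F q.proj q.2) (fibreCoord F q.proj β) = 0 := (verticalVector_eq q β).symm.trans hβ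
  have h6 : fibreCoord F q.proj β = 0 := by
    rw [← show _ = fibreCoord F q.proj β from h4]
    exact (congrArg (mfderiv (I.prod 𝓘(ℝ, F)) 𝓘(ℝ, F)
      (fun z : TotalSpace F V => (trivializationAt F V q.proj z).2)
      (fibreIncl q.proj (fibreCoord F q.proj q.2))) h5).trans (ContinuousLinearMap.map_zero _)
  simpa using h6

/-- The map `(X, β) ↦ X^h + β^v`. -/
def splittingMap (q : TotalSpace F V) :
    (TangentSpace I q.proj × V q.proj) →ₗ[ℝ] TangentSpace (I.prod 𝓘(ℝ, F)) q :=
  (horizontalLift nablaV q).coprod (verticalLift I q)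

theorem splittingMap_injective (q : TotalSpace F V) :
    Function.Injective (splittingMap nablaV q) := by
  rw [injective_iff_map_eq_zero]
  rintro ⟨X, β⟩ h
  simp only [splittingMap, LinearMap.coprod_apply] at h
  have hX : X = 0 := by
    have := congrArg (projVec I q) h
    rwa [map_add, projVec_horizontalLift, projVec_verticalLift, add_zero, map_zero] at this
  subst hX
  rw [map_zero, zero_add] at h
  have : β = 0 := verticalLift_injective q (h.trans (map_zero _).symm)
  rw [this]; rfl

/-- The isomorphism `(X, β) ↦ X^h + β^v`, that is, the splitting of the tangent space of the
total space at `q` into horizontal and vertical vectors. -/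
def tangentSplitting (q : TotalSpace F V) :
    (TangentSpace I q.proj × V q.proj) ≃ₗ[ℝ] TangentSpace (I.prod 𝓘(ℝ, F)) q :=
  haveI : FiniteDimensional ℝ (TangentSpace I q.proj × V q.proj) :=
    LinearEquiv.finiteDimensional (LinearEquiv.prodCongr (LinearEquiv.refl ℝ E)
      (fibreCoord F q.proj).symm.toLinearEquiv)
  haveI : FiniteDimensional ℝ (TangentSpace (I.prod 𝓘(ℝ, F)) q) :=
    inferInstanceAs (FiniteDimensional ℝ (E × F))
  LinearEquiv.ofInjectiveOfFinrankEq (splittingMap nablaV q) (splittingMap_injective nablaV q)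
    (LinearEquiv.finrank_eq (LinearEquiv.prodCongr (LinearEquiv.refl ℝ E)
      (fibreCoord F q.proj).toLinearEquiv))

theorem tangentSplitting_apply (q : TotalSpace F V) (X : TangentSpace I q.proj) (β : V q.proj) :
    tangentSplitting nablaV q (X, β) = horizontalLift nablaV q X + verticalLift I q β :=
  rfl

/-- The endomorphism `X^h + β^v ↦ (A X)^h + (B β)^v` of the tangent space of the total space. -/
def splittingEnd (q : TotalSpace F V) (A : TangentSpace I q.proj →ₗ[ℝ] TangentSpace I q.proj)
    (B : V q.proj →ₗ[ℝ] V q.proj) :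
    TangentSpace (I.prod 𝓘(ℝ, F)) q →ₗ[ℝ] TangentSpace (I.prod 𝓘(ℝ, F)) q :=
  (tangentSplitting nablaV q).toLinearMap ∘ₗ A.prodMap B ∘ₗ
    (tangentSplitting nablaV q).symm.toLinearMap

theorem splittingEnd_apply (q : TotalSpace F V)
    (A : TangentSpace I q.proj →ₗ[ℝ] TangentSpace I q.proj) (B : V q.proj →ₗ[ℝ] V q.proj)
    (X : TangentSpace I q.proj) (β : V q.proj) :
    splittingEnd nablaV q A B (horizontalLift nablaV q X + verticalLift I q β) =
      horizontalLift nablaV q (A X) + verticalLift I q (B β) := by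
  rw [← tangentSplitting_apply, ← tangentSplitting_apply]
  simp [splittingEnd]

/-- The space of the vectors `X^h + β^v` with `β` in a given subspace of the fibre. -/
def splittingSubspace (q : TotalSpace F V) (S : Submodule ℝ (V q.proj)) :
    Submodule ℝ (TangentSpace (I.prod 𝓘(ℝ, F)) q) :=
  LinearMap.range (horizontalLift nablaV q) ⊔ S.map (verticalLift I q)

end VectorBundleSplitting

/-! ### Densities -/

/-- The model space of 4-manifolds. -/
abbrev E4 : Type := EuclideanSpace ℝ (Fin 4)

section Manifold4

variable (M : Type*) [TopologicalSpace M] [ChartedSpace E4 M] [IsManifold (𝓡 4) ∞ M]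


theorem contDiff_clm_det : ContDiff ℝ ∞ (fun A : E4 →L[ℝ] E4 => A.det) := by
  have h : (fun A : E4 →L[ℝ] E4 => A.det) = fun A : E4 →L[ℝ] E4 =>
      ∑ σ : Equiv.Perm (Fin 4), ((Equiv.Perm.sign σ : ℤ) : ℝ) *
        ∏ i, (A (EuclideanSpace.single i 1)) (σ i) := by
    funext A
    have : A.det = LinearMap.det (A : E4 →ₗ[ℝ] E4) := rfl
    rw [this, ← LinearMap.det_toMatrix (EuclideanSpace.basisFun (Fin 4) ℝ).toBasis,
      Matrix.det_apply']
    simp [LinearMap.toMatrix_apply]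
  rw [h]
  fun_prop

theorem tangentCore_det_mul (i j k : atlas E4 M) {x : M}
    (hx : x ∈ i.1.source ∩ j.1.source ∩ k.1.source) :
    ((tangentBundleCore (𝓡 4) M).coordChange j k x).det *
      ((tangentBundleCore (𝓡 4) M).coordChange i j x).det =
      ((tangentBundleCore (𝓡 4) M).coordChange i k x).det := by
  have h : ((tangentBundleCore (𝓡 4) M).coordChange i k x : E4 →ₗ[ℝ] E4) =
      ((tangentBundleCore (𝓡 4) M).coordChange j k x : E4 →ₗ[ℝ] E4) ∘ₗ
        ((tangentBundleCore (𝓡 4) M).coordChange i j x : E4 →ₗ[ℝ] E4) :=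
    LinearMap.ext fun v => ((tangentBundleCore (𝓡 4) M).coordChange_comp i j k x hx v).symm
  simp only [ContinuousLinearMap.det, h, LinearMap.det_comp]

theorem tangentCore_det_self (i : atlas E4 M) {x : M} (hx : x ∈ i.1.source) :
    ((tangentBundleCore (𝓡 4) M).coordChange i i x).det = 1 := by
  have h : ((tangentBundleCore (𝓡 4) M).coordChange i i x : E4 →ₗ[ℝ] E4) = LinearMap.id :=
    LinearMap.ext fun v => (tangentBundleCore (𝓡 4) M).coordChange_self i x hx v
  simp only [ContinuousLinearMap.det, h, LinearMap.det_id]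

theorem tangentCore_det_ne_zero (i j : atlas E4 M) {x : M}
    (hx : x ∈ i.1.source ∩ j.1.source) :
    ((tangentBundleCore (𝓡 4) M).coordChange i j x).det ≠ 0 := by
  have h := tangentCore_det_mul M i j i ⟨hx, hx.1⟩
  rw [tangentCore_det_self M i hx.1] at h
  exact right_ne_zero_of_mul_eq_one h

theorem contMDiffOn_densityChange (w : ℝ) (i j : atlas E4 M) :
    ContMDiffOn (𝓡 4) 𝓘(ℝ, ℝ →L[ℝ] ℝ) ∞
      (fun x : M => (|((tangentBundleCore (𝓡 4) M).coordChange i j x).det| ^ (w / 4)) •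
        ContinuousLinearMap.id ℝ ℝ) (i.1.source ∩ j.1.source) := by
  intro x hx
  have : (tangentBundleCore (𝓡 4) M).IsContMDiff (𝓡 4) ∞ :=
    tangentBundleCore.isContMDiff (h := ‹IsManifold (𝓡 4) ∞ M›)
  have h1 : ContMDiffWithinAt (𝓡 4) 𝓘(ℝ, E4 →L[ℝ] E4) ∞
      ((tangentBundleCore (𝓡 4) M).coordChange i j) (i.1.source ∩ j.1.source) x :=
    (tangentBundleCore (𝓡 4) M).contMDiffOn_coordChange (n := ∞) (𝓡 4) i j x hx
  have h2 : ContDiffAt ℝ ∞ (fun A : E4 →L[ℝ] E4 =>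
      (|A.det| ^ (w / 4)) • ContinuousLinearMap.id ℝ ℝ)
      ((tangentBundleCore (𝓡 4) M).coordChange i j x) := by
    have h3 := tangentCore_det_ne_zero M i j hx
    exact (((contDiffAt_abs h3).comp _ contDiff_clm_det.contDiffAt).rpow_const_of_ne
      (by simpa using h3)).smul contDiffAt_const
  exact h2.contMDiffAt.comp_contMDiffWithinAt x h1

/-- The vector bundle core of the weight `w` density bundle `L^w`, `L = |Λ⁴TM|^(1/4)`: a density
is a real number in every chart, and these numbers change by the factor `|det A|^(w/4)`, where
`A` is the Jacobian of the change of charts. -/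
def densityCore (w : ℝ) : VectorBundleCore ℝ M ℝ (atlas E4 M) where
  baseSet i := i.1.source
  isOpen_baseSet i := i.1.open_source
  indexAt := achart E4
  mem_baseSet_at := mem_chart_source E4
  coordChange i j x :=
    (|((tangentBundleCore (𝓡 4) M).coordChange i j x).det| ^ (w / 4)) • ContinuousLinearMap.id ℝ ℝ
  coordChange_self i x hx v := by
    rw [tangentCore_det_self M i hx]; simp
  continuousOn_coordChange i j := (contMDiffOn_densityChange M w i j).continuousOn
  coordChange_comp i j k x hx v := by
    rw [← tangentCore_det_mul M i j k hx, abs_mul, Real.mul_rpow (abs_nonneg _) (abs_nonneg _)]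
    simp [mul_assoc]

instance densityCore_isContMDiff (w : ℝ) : (densityCore M w).IsContMDiff (𝓡 4) ∞ where
  contMDiffOn_coordChange i j := contMDiffOn_densityChange M w i j

variable {M}

/-- The line bundle `L^w` of densities of weight `w`. -/
def Density (w : ℝ) (x : M) : Type := (densityCore M w).Fiber x

section
variable (w : ℝ)

instance (x : M) : AddCommGroup (Density w x) := inferInstanceAs (AddCommGroup ℝ)
instance (x : M) : Module ℝ (Density w x) := inferInstanceAs (Module ℝ ℝ)
instance (x : M) : TopologicalSpace (Density w x) := inferInstanceAs (TopologicalSpace ℝ)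
instance (x : M) : IsTopologicalAddGroup (Density w x) :=
  inferInstanceAs (IsTopologicalAddGroup ℝ)
instance (x : M) : ContinuousSMul ℝ (Density w x) := inferInstanceAs (ContinuousSMul ℝ ℝ)
instance : TopologicalSpace (TotalSpace ℝ (Density (M := M) w)) :=
  inferInstanceAs (TopologicalSpace (TotalSpace ℝ (densityCore M w).Fiber))
instance : FiberBundle ℝ (Density (M := M) w) :=
  inferInstanceAs (FiberBundle ℝ (densityCore M w).Fiber)
instance : VectorBundle ℝ ℝ (Density (M := M) w) :=
  inferInstanceAs (VectorBundle ℝ ℝ (densityCore M w).Fiber)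
instance : ContMDiffVectorBundle ∞ ℝ (Density (M := M) w) (𝓡 4) :=
  inferInstanceAs (ContMDiffVectorBundle ∞ ℝ (densityCore M w).Fiber (𝓡 4))

end


/-- The model fibre of the bundle of bilinear forms. -/
abbrev BilinForm4 : Type := E4 →L[ℝ] E4 →L[ℝ] ℝ


/-- The bundle `L² ⊗ T*M ⊗ T*M` of bilinear forms on `TM` with values in `L²`. -/
abbrev WForm (x : M) : Type :=
  TangentSpace (𝓡 4) x →L[ℝ] TangentSpace (𝓡 4) x →L[ℝ] Density 2 x


/-- The product `L ⊗ L → L²` of densities at a point. -/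
def densityMul (x : M) : Density 1 x →L[ℝ] Density 1 x →L[ℝ] Density 2 x :=
  (ContinuousLinearMap.mul ℝ ℝ : ℝ →L[ℝ] ℝ →L[ℝ] ℝ)

/-- The coordinate of a density at `x` with respect to the density `|∂₁ ∧ ⋯ ∧ ∂₄|^(w/4)` of the
preferred chart at `x`. -/
def densityCoord {w : ℝ} {x : M} (a : Density w x) : ℝ := a

/-- The real number `a / b` for densities `a`, `b` of the same weight (`b ≠ 0`). -/
def densityRatio {w : ℝ} {x : M} (a b : Density w x) : ℝ := densityCoord a / densityCoord b

/-- The density `|∂₁ ∧ ⋯ ∧ ∂₄|^(w/4)` at `x` of the preferred chart at `x`. -/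
def densityUnit (w : ℝ) (x : M) : Density w x := (1 : ℝ)

/-- A local length scale near `x`, that is, a nowhere zero local section of `L`. -/
def localScale (x : M) : (y : M) → Density 1 y := extend ℝ (densityUnit 1 x)

theorem densityRatio_localScale_eventuallyEq (τ : (y : M) → Density 2 y) (x : M) :
    (fun y => densityRatio (τ y) (densityMul y (localScale x y) (localScale x y))) =ᶠ[𝓝 x]
      fun y => (trivializationAt ℝ (Density (M := M) 2) x ⟨y, τ y⟩).2 := by
  filter_upwards [(chartAt E4 x).open_source.mem_nhds (mem_chart_source E4 x)] with y hy
  have hd := tangentCore_det_ne_zero M (achart E4 y) (achart E4 x) (x := y)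
    ⟨mem_chart_source E4 y, hy⟩
  set d := ((tangentBundleCore (𝓡 4) M).coordChange (achart E4 y) (achart E4 x) y).det with hdd
  have hμ : |d| ^ ((1 : ℝ) / 4) * (densityCoord (localScale x y)) = 1 := by
    have h1 := (trivializationAt ℝ (Density (M := M) 1) x).apply_mk_symm (b := y) hy
      (trivializationAt ℝ (Density (M := M) 1) x ⟨x, densityUnit 1 x⟩).2
    have h2 := congrArg Prod.snd h1
    have h3 : (trivializationAt ℝ (Density (M := M) 1) x
        ⟨x, densityUnit 1 x⟩).2 = (1 : ℝ) :=
      (densityCore M 1).coordChange_self (achart E4 x) x (mem_chart_source E4 x) 1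
    exact h2.trans h3
  have hτ : (trivializationAt ℝ (Density (M := M) 2) x ⟨y, τ y⟩).2 =
      |d| ^ ((2 : ℝ) / 4) * (densityCoord (τ y)) := rfl
  have hr : |d| ^ ((2 : ℝ) / 4) = |d| ^ ((1 : ℝ) / 4) * |d| ^ ((1 : ℝ) / 4) := by
    rw [← Real.rpow_add (abs_pos.mpr hd)]; norm_num
  rw [hτ, hr]
  change (densityCoord (τ y)) / ((densityCoord (localScale x y)) * (densityCoord (localScale x y))) = _
  have h0 : (densityCoord (localScale x y)) ≠ 0 := right_ne_zero_of_mul_eq_one hμ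
  rw [div_eq_iff (mul_ne_zero h0 h0)]
  linear_combination (-(densityCoord (τ y))) *
    (|d| ^ ((1 : ℝ) / 4) * (densityCoord (localScale x y)) + 1) * hμ

theorem mdifferentiableAt_densityRatio {τ : (y : M) → Density 2 y} {x : M}
    (hτ : MDifferentiableAt (𝓡 4) ((𝓡 4).prod 𝓘(ℝ, ℝ)) (fun y => TotalSpace.mk' ℝ y (τ y)) x) :
    MDifferentiableAt (𝓡 4) 𝓘(ℝ, ℝ)
      (fun y => densityRatio (τ y) (densityMul y (localScale x y) (localScale x y))) x :=
  ((mdifferentiableAt_section (𝓡 4) τ).1 hτ).congr_of_eventuallyEq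
    (densityRatio_localScale_eventuallyEq τ x)

/-- The connection on `L²` induced by a connection `D` on `L`: writing `τ = h μ²` with a local
length scale `μ`, it is `D τ = dh μ² + 2 h μ D μ`. -/
def squareConnection (D : CovariantDerivative (𝓡 4) ℝ (Density (M := M) 1)) :
    CovariantDerivative (𝓡 4) ℝ (Density (M := M) 2) where
  toFun τ x :=
    (mvfderiv (𝓡 4) (fun y => densityRatio (τ y) (densityMul y (localScale x y) (localScale x y))) x).smulRight
        (densityMul x (localScale x x) (localScale x x)) +
      (2 * densityRatio (τ x) (densityMul x (localScale x x) (localScale x x))) •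
        (densityMul x (localScale x x)).comp (D (localScale x) x)
  isCovariantDerivativeOnUniv := by
    constructor
    · intro σ σ' x hσ hσ' _
      have h : (fun y => densityRatio ((σ + σ') y)
          (densityMul y (localScale x y) (localScale x y))) =
          (fun y => densityRatio (σ y) (densityMul y (localScale x y) (localScale x y))) +
          (fun y => densityRatio (σ' y) (densityMul y (localScale x y) (localScale x y))) := by
        funext y; exact add_div _ _ _
      rw [h, mvfderiv_add (mdifferentiableAt_densityRatio hσ) (mdifferentiableAt_densityRatio hσ'),
        congrFun h x]
      ext v
      simp
      module
    · intro σ g x hσ hg _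
      have h : (fun y => densityRatio ((g • σ) y)
          (densityMul y (localScale x y) (localScale x y))) =
          g • (fun y => densityRatio (σ y) (densityMul y (localScale x y) (localScale x y))) := by
        funext y; exact mul_div_assoc _ _ _
      have h1 : densityRatio (σ x) (densityMul x (localScale x x) (localScale x x)) •
          densityMul x (localScale x x) (localScale x x) = σ x := by
        have : localScale x x = densityUnit 1 x := extend_apply_self _ _
        rw [this]
        change (densityCoord (σ x)) / ((1 : ℝ) * 1) * ((1 : ℝ) * 1) = (densityCoord (σ x))
        ring
      rw [h, mvfderiv_smul hg (mdifferentiableAt_densityRatio hσ), congrFun h x]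
      have h2 : (mvfderiv (𝓡 4) g x).smulRight (σ x) = (mvfderiv (𝓡 4) g x).smulRight
          (densityRatio (σ x) (densityMul x (localScale x x) (localScale x x)) •
            densityMul x (localScale x x) (localScale x x)) := by rw [h1]
      rw [h2]
      ext v
      simp
      module

/-- `(∇_Z B)(X, Y) = D_Z (B(X, Y)) - B(∇_Z X, Y) - B(X, ∇_Z Y)` at `x`. -/
def bilinCovAux (nabla : CovariantDerivative (𝓡 4) E4 (TangentSpace (𝓡 4) : M → Type))
    (D : CovariantDerivative (𝓡 4) ℝ (Density (M := M) 1)) (B : (y : M) → WForm y) (x : M)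
    (Z : TangentSpace (𝓡 4) x) (X Y : (y : M) → TangentSpace (𝓡 4) y) : Density 2 x :=
  squareConnection D (fun y => B y (X y) (Y y)) x Z
    - B x (nabla X x Z) (Y x) - B x (X x) (nabla Y x Z)

/-- Differentiability at a point of an `L²`-valued bilinear form. -/
abbrev MDiffForm (B : (y : M) → WForm y) (x : M) : Prop :=
  MDifferentiableAt (𝓡 4) ((𝓡 4).prod 𝓘(ℝ, BilinForm4))
    (fun y => TotalSpace.mk' BilinForm4 y (B y)) x

/-- Differentiability at a point of a vector field. -/
abbrev MDiffField (X : (y : M) → TangentSpace (𝓡 4) y) (x : M) : Prop :=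
  MDifferentiableAt (𝓡 4) ((𝓡 4).prod 𝓘(ℝ, E4)) (fun y => TotalSpace.mk' E4 y (X y)) x

variable (nabla : CovariantDerivative (𝓡 4) E4 (TangentSpace (𝓡 4) : M → Type))
    (D : CovariantDerivative (𝓡 4) ℝ (Density (M := M) 1))

theorem bilinCovAux_tensorial_left {B : (y : M) → WForm y} {x : M} (hB : MDiffForm B x)
    (Z : TangentSpace (𝓡 4) x) (Y : (y : M) → TangentSpace (𝓡 4) y) (hY : MDiffField Y x) :
    TensorialAt (𝓡 4) E4 (fun X => bilinCovAux nabla D B x Z X Y) x where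
  smul {f X} hf hX := by
    have h1 : (fun y => B y ((f • X) y) (Y y)) = f • fun y => B y (X y) (Y y) := by
      funext y; simp
    have h2 := (squareConnection D).isCovariantDerivativeOnUniv.leibniz
      (hB.clm_bundle_apply₂ hX hY) hf
    have h3 := nabla.isCovariantDerivativeOnUniv.leibniz hX hf
    simp only [bilinCovAux, h1]
    rw [h2, h3]
    simp
    module
  add {X X'} hX hX' := by
    have h1 : (fun y => B y ((X + X') y) (Y y)) =
        (fun y => B y (X y) (Y y)) + fun y => B y (X' y) (Y y) := by
      funext y; simp
    have h2 := (squareConnection D).isCovariantDerivativeOnUniv.add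
      (hB.clm_bundle_apply₂ hX hY) (hB.clm_bundle_apply₂ hX' hY)
    have h3 := nabla.isCovariantDerivativeOnUniv.add hX hX'
    simp only [bilinCovAux, h1]
    rw [h2, h3]
    simp
    abel

theorem bilinCovAux_tensorial_right {B : (y : M) → WForm y} {x : M} (hB : MDiffForm B x)
    (Z : TangentSpace (𝓡 4) x) (X : (y : M) → TangentSpace (𝓡 4) y) (hX : MDiffField X x) :
    TensorialAt (𝓡 4) E4 (fun Y => bilinCovAux nabla D B x Z X Y) x where
  smul {f Y} hf hY := by
    have h1 : (fun y => B y (X y) ((f • Y) y)) = f • fun y => B y (X y) (Y y) := by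
      funext y; simp
    have h2 := (squareConnection D).isCovariantDerivativeOnUniv.leibniz
      (hB.clm_bundle_apply₂ hX hY) hf
    have h3 := nabla.isCovariantDerivativeOnUniv.leibniz hY hf
    simp only [bilinCovAux, h1]
    rw [h2, h3]
    simp
    module
  add {Y Y'} hY hY' := by
    have h1 : (fun y => B y (X y) ((Y + Y') y)) =
        (fun y => B y (X y) (Y y)) + fun y => B y (X y) (Y' y) := by
      funext y; simp
    have h2 := (squareConnection D).isCovariantDerivativeOnUniv.add
      (hB.clm_bundle_apply₂ hX hY) (hB.clm_bundle_apply₂ hX hY')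
    have h3 := nabla.isCovariantDerivativeOnUniv.add hY hY'
    simp only [bilinCovAux, h1]
    rw [h2, h3]
    simp
    abel

open scoped Classical in
/-- The covariant derivative `Z ↦ ∇_Z B` at `x` of an `L²`-valued bilinear form, induced by a
connection on `TM` and a connection on `L` (and `0` where `B` is not differentiable). -/
def bilinCov (B : (y : M) → WForm y) (x : M) : TangentSpace (𝓡 4) x →ₗ[ℝ] WForm x :=
  if hB : MDiffForm B x then
    { toFun := fun Z => TensorialAt.mkHom₂ (bilinCovAux nabla D B x Z) x
        (fun Y hY => bilinCovAux_tensorial_left nabla D hB Z Y hY)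
        (fun X hX => bilinCovAux_tensorial_right nabla D hB Z X hX)
      map_add' := fun Z Z' => by
        ext X Y
        simp only [add_apply, TensorialAt.mkHom₂_apply_eq_extend, bilinCovAux,
          map_add]
        abel
      map_smul' := fun a Z => by
        ext X Y
        simp only [smul_apply, TensorialAt.mkHom₂_apply_eq_extend, bilinCovAux,
          map_smul, RingHom.id_apply]
        module }
  else 0

/-! ### Conformal metrics, almost complex structures and Weyl connections -/

/-- The coordinate vector field `∂ᵢ` of the preferred chart at `x`, at the point `x`. -/
def coordVector (x : M) (i : Fin 4) : TangentSpace (𝓡 4) x := EuclideanSpace.single i (1 : ℝ)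

variable (M) in
/-- A smooth conformal metric: a metric on `TM` with values in `L²`, normalized by
`|det c| = 1`. Here `det (c(∂ᵢ, ∂ⱼ))` is a density of weight 8, compared with
`|∂₁ ∧ ⋯ ∧ ∂₄|²`. -/
structure ConformalMetric where
  form : (x : M) → WForm x
  symm : ∀ (x : M) (v w : TangentSpace (𝓡 4) x), form x v w = form x w v
  pos : ∀ (x : M) (v : TangentSpace (𝓡 4) x), v ≠ 0 → 0 < densityCoord (form x v v)
  normalized : ∀ x : M, |(Matrix.of fun i j : Fin 4 =>
    densityCoord (form x (coordVector x i) (coordVector x j))).det| = 1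
  smooth : ContMDiff (𝓡 4) ((𝓡 4).prod 𝓘(ℝ, BilinForm4)) ∞
    (fun x => TotalSpace.mk' BilinForm4 x (form x))

variable (M) in
/-- A smooth almost complex structure. -/
structure AlmostComplexStructure where
  toFun : (x : M) → TangentSpace (𝓡 4) x →L[ℝ] TangentSpace (𝓡 4) x
  sq : ∀ (x : M) (v : TangentSpace (𝓡 4) x), toFun x (toFun x v) = -v
  smooth : ContMDiff (𝓡 4) ((𝓡 4).prod 𝓘(ℝ, E4 →L[ℝ] E4)) ∞
    (fun x => TotalSpace.mk' (E4 →L[ℝ] E4)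
      (E := fun x : M => TangentSpace (𝓡 4) x →L[ℝ] TangentSpace (𝓡 4) x) x (toFun x))

/-- `(M, c, J)` is conformally almost-Hermitian. -/
def IsConformallyAlmostHermitian (c : ConformalMetric M) (J : AlmostComplexStructure M) : Prop :=
  ∀ (x : M) (v w : TangentSpace (𝓡 4) x),
    c.form x v w = c.form x (J.toFun x v) (J.toFun x w)

/-- The conformal Kähler form `ω_c = c(J·, ·)`. -/
def kaehlerForm (c : ConformalMetric M) (J : AlmostComplexStructure M) (x : M) : WForm x :=
  (c.form x).comp (J.toFun x)

/-- The exterior covariant derivative `(d^D B)(X, Y, Z)` at `x` of an `L²`-valued 2-form `B`. -/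
def extCov (D : CovariantDerivative (𝓡 4) ℝ (Density (M := M) 1)) (B : (y : M) → WForm y)
    (X Y Z : (y : M) → TangentSpace (𝓡 4) y) (x : M) : Density 2 x :=
  squareConnection D (fun y => B y (Y y) (Z y)) x (X x)
    - squareConnection D (fun y => B y (X y) (Z y)) x (Y x)
    + squareConnection D (fun y => B y (X y) (Y y)) x (Z x)
    - B x (VectorField.mlieBracket (𝓡 4) X Y x) (Z x)
    + B x (VectorField.mlieBracket (𝓡 4) X Z x) (Y x)
    - B x (VectorField.mlieBracket (𝓡 4) Y Z x) (X x)

/-- `D` is the canonical Weyl derivative of `(M, c, J)`: `d^D ω_c = 0`. -/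
def IsCanonicalWeylDerivative (c : ConformalMetric M) (J : AlmostComplexStructure M)
    (D : CovariantDerivative (𝓡 4) ℝ (Density (M := M) 1)) : Prop :=
  ∀ (x : M) (X Y Z : (y : M) → TangentSpace (𝓡 4) y),
    MDiffField X x → MDiffField Y x → MDiffField Z x → extCov D (kaehlerForm c J) X Y Z x = 0

/-- `nabla` is the Weyl connection `∇^D` of `(M, c, D)`: it is torsion free and `c` is parallel. -/
def IsWeylConnection (c : ConformalMetric M)
    (D : CovariantDerivative (𝓡 4) ℝ (Density (M := M) 1))
    (nabla : CovariantDerivative (𝓡 4) E4 (TangentSpace (𝓡 4) : M → Type)) : Prop :=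
  nabla.torsion = 0 ∧ ∀ x : M, bilinCov nabla D c.form x = 0

/-- The orientation `o` of `M` is the one given by `J`: frames `(u, Ju, v, Jv)` are positive. -/
def IsComplexOrientation (J : AlmostComplexStructure M)
    (o : (x : M) → Orientation ℝ (TangentSpace (𝓡 4) x) (Fin 4)) : Prop :=
  ∀ (x : M) (b : Module.Basis (Fin 4) ℝ (TangentSpace (𝓡 4) x)),
    b 1 = J.toFun x (b 0) → b 3 = J.toFun x (b 2) → b.orientation = o x

/-! ### The weightless twistor space -/

variable (M) in
/-- The total space of `L² ⊗ T*M ⊗ T*M`. -/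
abbrev FormTotal := TotalSpace BilinForm4 (WForm (M := M))

/-- The model with corners of the total space. -/
abbrev FormModel : ModelWithCorners ℝ (E4 × BilinForm4) (ModelProd E4 BilinForm4) :=
  (𝓡 4).prod 𝓘(ℝ, BilinForm4)

/-- `β` is an `L²`-valued 2-form at `x`. -/
def IsTwoForm {x : M} (β : WForm x) : Prop := ∀ v : TangentSpace (𝓡 4) x, β v v = 0

/-- `e` is a positively oriented frame at `x` with `c(eᵢ, eⱼ) = δᵢⱼ m`. -/
structure IsConformalFrame (c : ConformalMetric M)
    (o : (x : M) → Orientation ℝ (TangentSpace (𝓡 4) x) (Fin 4)) (x : M)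
    (e : Module.Basis (Fin 4) ℝ (TangentSpace (𝓡 4) x)) (m : Density 2 x) : Prop where
  orthogonal : ∀ i j : Fin 4, c.form x (e i) (e j) = if i = j then m else 0
  positive : e.orientation = o x

/-- The weightless components `β(eᵢ, eⱼ) / m` of an `L²`-valued 2-form. -/
def frameCoeff {x : M} (e : Module.Basis (Fin 4) ℝ (TangentSpace (𝓡 4) x)) (m : Density 2 x)
    (β : WForm x) (i j : Fin 4) : ℝ := densityRatio (β (e i) (e j)) m

/-- The inner product `c(β, γ)` of `L²`-valued 2-forms, computed in a conformal frame. -/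
def formInner {x : M} (e : Module.Basis (Fin 4) ℝ (TangentSpace (𝓡 4) x)) (m : Density 2 x)
    (β γ : WForm x) : ℝ :=
  ∑ i : Fin 4, ∑ j ∈ Finset.Ioi i, frameCoeff e m β i j * frameCoeff e m γ i j

/-- The number `t` with `β ∧ γ = t ν_c`, where `ν_c(e₀, e₁, e₂, e₃) = m²` for positively oriented
conformal frames. -/
def formWedge {x : M} (e : Module.Basis (Fin 4) ℝ (TangentSpace (𝓡 4) x)) (m : Density 2 x)
    (β γ : WForm x) : ℝ :=
  frameCoeff e m β 0 1 * frameCoeff e m γ 2 3 - frameCoeff e m β 0 2 * frameCoeff e m γ 1 3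
    + frameCoeff e m β 0 3 * frameCoeff e m γ 1 2 + frameCoeff e m β 1 2 * frameCoeff e m γ 0 3
    - frameCoeff e m β 1 3 * frameCoeff e m γ 0 2 + frameCoeff e m β 2 3 * frameCoeff e m γ 0 1

/-- `⋆γ = γ` for the conformal Hodge star, `β ∧ ⋆γ = c(β, γ) ν_c`. -/
def IsSelfDual (c : ConformalMetric M)
    (o : (x : M) → Orientation ℝ (TangentSpace (𝓡 4) x) (Fin 4)) {x : M} (γ : WForm x) : Prop :=
  ∀ e m, IsConformalFrame c o x e m → ∀ β : WForm x, IsTwoForm β →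
    formWedge e m β γ = formInner e m β γ

/-- The weightless twistor space `Z_+ = S(L² Λ²_+ T*M)`. The radius of the spheres is `√2` for the
inner product in which the `eⁱ ∧ eʲ` are orthonormal, the norm of `c(J·, ·)` for an orthogonal
complex structure `J`. -/
def twistorSpacePlus (c : ConformalMetric M)
    (o : (x : M) → Orientation ℝ (TangentSpace (𝓡 4) x) (Fin 4)) : Set (FormTotal M) :=
  {q | IsTwoForm q.2 ∧ IsSelfDual c o q.2 ∧
    ∀ e m, IsConformalFrame c o q.proj e m → formInner e m q.2 q.2 = 2}

/-- The endomorphism `J_q` of the tangent space with `q(X, Y) = c(J_q X, Y)`. -/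
def endoOfForm (c : ConformalMetric M) (q : FormTotal M) :
    TangentSpace (𝓡 4) q.proj →L[ℝ] TangentSpace (𝓡 4) q.proj :=
  (c.form q.proj).inverse.comp q.2

/-- The action `(A β)(X, Y) = β(A X, Y)` of an endomorphism on bilinear forms. -/
def formAct {x : M} (A : TangentSpace (𝓡 4) x →L[ℝ] TangentSpace (𝓡 4) x) :
    WForm x →ₗ[ℝ] WForm x where
  toFun β := β.comp A
  map_add' _ _ := rfl
  map_smul' _ _ := rfl

/-- The `L²`-valued 2-forms that are anti-invariant under `J_q`. -/
def antiInvariantForms (c : ConformalMetric M) (q : FormTotal M) :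
    Submodule ℝ (WForm q.proj) where
  carrier := {β | IsTwoForm β ∧ ∀ v w : TangentSpace (𝓡 4) q.proj,
    β (endoOfForm c q v) (endoOfForm c q w) = -β v w}
  add_mem' := by
    rintro β β' ⟨h1, h2⟩ ⟨h1', h2'⟩
    refine ⟨fun v => ?_, fun v w => ?_⟩
    · simp [h1 v, h1' v]
    · simp only [add_apply, h2, h2']; abel
  zero_mem' := ⟨fun v => by simp, fun v w => by simp⟩
  smul_mem' := by
    rintro a β ⟨h1, h2⟩
    refine ⟨fun v => ?_, fun v w => ?_⟩
    · simp [h1 v]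
    · simp only [smul_apply, h2, smul_neg]

/-- The tangent space at `q` of the twistor space, inside the tangent space of the total space of
`L² ⊗ T*M ⊗ T*M`: the vectors `X^h + β^v` with `β` anti-invariant under `J_q`. -/
def twistorTangent (c : ConformalMetric M)
    (D : CovariantDerivative (𝓡 4) ℝ (Density (M := M) 1))
    (nabla : CovariantDerivative (𝓡 4) E4 (TangentSpace (𝓡 4) : M → Type)) (q : FormTotal M) :
    Submodule ℝ (TangentSpace FormModel q) :=
  splittingSubspace (bilinCov nabla D) q (antiInvariantForms c q)

/-- The almost complex structure `𝒥_+`: `X^h + β^v ↦ (J_q X)^h + (J_q β)^v`. -/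
def twistorJ (c : ConformalMetric M)
    (D : CovariantDerivative (𝓡 4) ℝ (Density (M := M) 1))
    (nabla : CovariantDerivative (𝓡 4) E4 (TangentSpace (𝓡 4) : M → Type)) (q : FormTotal M) :
    TangentSpace FormModel q →ₗ[ℝ] TangentSpace FormModel q :=
  splittingEnd (bilinCov nabla D) q (endoOfForm c q).toLinearMap (formAct (endoOfForm c q))

/-- The section of the bundle `L² ⊗ T*M ⊗ T*M` given by `ω_c`. -/
def kaehlerSection (c : ConformalMetric M) (J : AlmostComplexStructure M) (x : M) : FormTotal M :=
  ⟨x, kaehlerForm c J x⟩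

/-- The differential of that section. -/
def kaehlerSectionDeriv (c : ConformalMetric M) (J : AlmostComplexStructure M) (x : M) :
    TangentSpace (𝓡 4) x →L[ℝ] TangentSpace FormModel (kaehlerSection c J x) :=
  mfderiv (𝓡 4) FormModel (kaehlerSection c J) x

end Manifold4

end

end WeylTwistor

/-!
Since `∇c = 0`, the form `∇_Z ω` measures the failure of `∇_Z` to commute with `J`, and
differentiating `J² = -1` shows that it is `J`-anti-invariant. As `∇` is torsion free, `d^D ω = 0`
says that the cyclic sum of `(∇_X ω)(Y, Z)` vanishes, and a 2-form-valued tensor with these two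
properties satisfies `∇_{JZ} ω = J (∇_Z ω)`. The horizontal part of `ds(Z)` is `Zʰ` and its
vertical part is `(∇_Z ω)ᵛ`, so this identity is the holomorphicity of `s`. In an oriented
orthonormal frame the matrix `A` of `ω` is alternating with `A² = -1`, which forces
`⋆A = Pf(A) A` and `Pf(A) = ±1`; complex frames being positive, `Pf(A) = 1`.
-/

namespace WeylTwistor

/-! ### Covariant derivatives and the differential of a section -/

section Sections

variable {E : Type*} [NormedAddCommGroup E] [NormedSpace ℝ E]
  {H : Type*} [TopologicalSpace H] {I : ModelWithCorners ℝ E H}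
  {M : Type*} [TopologicalSpace M] [ChartedSpace H M]
  {F : Type*} [NormedAddCommGroup F] [NormedSpace ℝ F]

theorem mvfderiv_eq_sum_repr_smul {ι : Type*} [Fintype ι] (b : Module.Basis ι ℝ F)
    {f : M → F} {x : M} (hf : MDifferentiableAt I 𝓘(ℝ, F) f x)
    (Z : TangentSpace I x) :
    mvfderiv I f x Z = ∑ i, mvfderiv I (fun y => b.repr (f y) i) x Z • b i := by
  have := Module.Finite.of_basis b
  have hcoord (i : ι) : mvfderiv I (fun y => b.repr (f y) i) x Z =
      b.repr (mvfderiv I f x Z) i :=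
    congrArg (fun A => A Z)
      ((LinearMap.toContinuousLinearMap (b.coord i)).hasMFDerivAt.comp x hf.hasMFDerivAt).mfderiv
  simp only [hcoord, b.sum_repr]

variable {V : M → Type*} [TopologicalSpace (TotalSpace F V)]
  [∀ x, TopologicalSpace (V x)] [FiberBundle F V]

variable (I) in
/-- The differential at `q` of the fibre coordinate of the trivialization over `π q`. Together with
`projVec` it detects tangent vectors of the total space. -/
noncomputable def fibreCoordDeriv (q : TotalSpace F V) :
    TangentSpace (I.prod 𝓘(ℝ, F)) q →L[ℝ] F :=
  mfderiv (I.prod 𝓘(ℝ, F)) 𝓘(ℝ, F)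
    (fun z : TotalSpace F V => (trivializationAt F V q.proj z).2) q

theorem hasMFDerivAt_fibreCoord (q : TotalSpace F V) :
    HasMFDerivAt (I.prod 𝓘(ℝ, F)) 𝓘(ℝ, F)
      (fun z : TotalSpace F V => (trivializationAt F V q.proj z).2) q (fibreCoordDeriv I q) :=
  ((mdifferentiableAt_totalSpace I (fun z : TotalSpace F V => z)).1
    mdifferentiableAt_id).2.hasMFDerivAt

theorem fibreCoordDeriv_mfderiv_section {σ : (y : M) → V y} {x : M}
    (hσ : MDifferentiableAt I (I.prod 𝓘(ℝ, F)) (fun y => TotalSpace.mk' F y (σ y)) x)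
    {q : TotalSpace F V} (hq : TotalSpace.mk' F x (σ x) = q) (Z : TangentSpace I x) :
    fibreCoordDeriv I q (mfderiv I (I.prod 𝓘(ℝ, F)) (fun y => TotalSpace.mk' F y (σ y)) x Z) =
      mvfderiv I (fun y => (trivializationAt F V x ⟨y, σ y⟩).2) x Z := by
  subst hq
  exact congrArg (fun L => L Z)
    ((hasMFDerivAt_fibreCoord (TotalSpace.mk' F x (σ x))).comp x hσ.hasMFDerivAt).mfderiv.symm

theorem projVec_mfderiv_section {σ : (y : M) → V y} {x : M}
    (hσ : MDifferentiableAt I (I.prod 𝓘(ℝ, F)) (fun y => TotalSpace.mk' F y (σ y)) x)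
    (Z : TangentSpace I x) :
    projVec I (TotalSpace.mk' F x (σ x))
      (mfderiv I (I.prod 𝓘(ℝ, F)) (fun y => TotalSpace.mk' F y (σ y)) x Z) = Z := by
  have hproj : HasMFDerivAt (I.prod 𝓘(ℝ, F)) I (TotalSpace.proj : TotalSpace F V → M)
      (TotalSpace.mk' F x (σ x)) (projVec I (TotalSpace.mk' F x (σ x))) :=
    (mdifferentiable_proj V _).hasMFDerivAt
  exact congrArg (fun L => L Z)
    (hasMFDerivAt_unique (hproj.comp x hσ.hasMFDerivAt) (hasMFDerivAt_id x))

variable [∀ x, AddCommGroup (V x)]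

omit [NormedSpace ℝ F] in
theorem trivializationAt_extend_eventuallyEq {x : M} (v : V x) :
    (fun y => (trivializationAt F V x ⟨y, extend F v y⟩).2) =ᶠ[𝓝 x]
      fun _ => (trivializationAt F V x ⟨x, v⟩).2 := by
  filter_upwards [(trivializationAt F V x).open_baseSet.mem_nhds
    (mem_baseSet_trivializationAt F V x)] with y hy
  rw [extend, Trivialization.apply_mk_symm _ hy]

theorem mvfderiv_trivializationAt_extend {x : M} (v : V x) :
    mvfderiv I (fun y => (trivializationAt F V x ⟨y, extend F v y⟩).2) x = 0 :=
  ((hasMFDerivAt_const _ x).congr_of_eventuallyEq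
    (trivializationAt_extend_eventuallyEq v)).mfderiv

theorem fibreCoordDeriv_extendDeriv (q : TotalSpace F V) (X : TangentSpace I q.proj) :
    fibreCoordDeriv I q (extendDeriv I q X) = (0 : F) := by
  have h := fibreCoordDeriv_mfderiv_section (mdifferentiableAt_extend I F q.2) (q := q)
    (by rw [extend_apply_self]) X
  rw [mvfderiv_trivializationAt_extend] at h
  exact h

variable [∀ x, Module ℝ (V x)] [VectorBundle ℝ F V]

theorem eventually_eq_sum_repr_smul_extend {ι : Type*} [Fintype ι] (b : Module.Basis ι ℝ F)
    (σ : (y : M) → V y) (x : M) :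
    ∀ᶠ y in 𝓝 x, σ y = ∑ i, b.repr (trivializationAt F V x ⟨y, σ y⟩).2 i •
      extend F ((fibreCoord F x).symm (b i)) y := by
  have := Module.Finite.of_basis b
  filter_upwards [(trivializationAt F V x).open_baseSet.mem_nhds
    (mem_baseSet_trivializationAt F V x)] with y hy
  have hextend (i : ι) : extend F ((fibreCoord F x).symm (b i)) y =
      (trivializationAt F V x).symmL ℝ y (b i) := by
    rw [extend, ← fibreCoord_apply, ContinuousLinearEquiv.apply_symm_apply,
      Trivialization.symmL_apply _ hy]
  simp only [hextend, ← map_smul, ← map_sum, b.sum_repr]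
  rw [Trivialization.symmL_apply _ hy, Trivialization.symm_apply_apply_mk _ hy]

section CovariantDerivative

variable [∀ x, IsTopologicalAddGroup (V x)] [∀ x, ContinuousSMul ℝ (V x)]
  {cov : (σ : (x : M) → V x) → (x : M) → TangentSpace I x →L[ℝ] V x}

theorem covariantDerivative_sum (hcov : IsCovariantDerivativeOn F cov) {ι : Type*}
    (s : Finset ι) {σ : ι → (y : M) → V y} {x : M}
    (hσ : ∀ i, MDifferentiableAt I (I.prod 𝓘(ℝ, F)) (fun y => TotalSpace.mk' F y (σ i y)) x) :
    cov (∑ i ∈ s, σ i) x = ∑ i ∈ s, cov (σ i) x := by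
  classical
  induction s using Finset.induction_on with
  | empty => simpa using hcov.zero (x := x)
  | insert i s his ih =>
    rw [Finset.sum_insert his, Finset.sum_insert his, ← ih]
    refine hcov.add (hσ i) ?_
    simpa using MDifferentiableAt.sum_section (s := s) fun i _ => hσ i

theorem covariantDerivative_eq_sum (hcov : IsCovariantDerivativeOn F cov) {ι : Type*} [Fintype ι]
    (b : Module.Basis ι ℝ F) {σ : (y : M) → V y} {x : M}
    (hσ : MDifferentiableAt I (I.prod 𝓘(ℝ, F)) (fun y => TotalSpace.mk' F y (σ y)) x)
    (Z : TangentSpace I x) :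
    cov σ x Z = (fibreCoord F x).symm
        (mvfderiv I (fun y => (trivializationAt F V x ⟨y, σ y⟩).2) x Z) +
      ∑ i, b.repr (fibreCoord F x (σ x)) i •
        cov (extend F ((fibreCoord F x).symm (b i))) x Z := by
  have := Module.Finite.of_basis b
  have hcoord := (mdifferentiableAt_section I σ).1 hσ
  set f : M → F := fun y => (trivializationAt F V x ⟨y, σ y⟩).2
  set e : ι → (y : M) → V y := fun i => extend F ((fibreCoord F x).symm (b i))
  set g : ι → M → ℝ := fun i y => b.repr (f y) i
  have he' (i : ι) : MDifferentiableAt I (I.prod 𝓘(ℝ, F))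
      (fun y => TotalSpace.mk' F y (e i y)) x := mdifferentiableAt_extend I F _
  have hg (i : ι) : MDifferentiableAt I 𝓘(ℝ, ℝ) (g i) x :=
    (LinearMap.toContinuousLinearMap (b.coord i)).mdifferentiableAt.comp x hcoord
  have hge (i : ι) : MDifferentiableAt I (I.prod 𝓘(ℝ, F))
      (fun y => TotalSpace.mk' F y ((g i • e i) y)) x := (hg i).smul_section (he' i)
  have hgerm : cov σ x = cov (∑ i, g i • e i) x := by
    refine hcov.congr_of_eventuallyEq hσ ?_ Filter.univ_mem ?_
    · simpa using MDifferentiableAt.sum_section (s := Finset.univ) fun i _ => hge i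
    · simpa [g, e, f] using eventually_eq_sum_repr_smul_extend b σ x
  have hex (i : ι) : e i x = (fibreCoord F x).symm (b i) := extend_apply_self _ _
  rw [hgerm, covariantDerivative_sum hcov _ hge, mvfderiv_eq_sum_repr_smul b hcoord, map_sum,
    ← Finset.sum_add_distrib, sum_apply]
  refine Finset.sum_congr rfl fun i _ => ?_
  rw [hcov.leibniz (he' i) (hg i), add_apply, smul_apply, ContinuousLinearMap.smulRight_apply,
    hex, map_smul, add_comm, fibreCoord_apply]

theorem fibreCoord_covariantDerivative_sub_extend [FiniteDimensional ℝ F]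
    (hcov : IsCovariantDerivativeOn F cov) {σ : (y : M) → V y} {x : M}
    (hσ : MDifferentiableAt I (I.prod 𝓘(ℝ, F)) (fun y => TotalSpace.mk' F y (σ y)) x)
    (Z : TangentSpace I x) :
    fibreCoord F x (cov σ x Z - cov (extend F (σ x)) x Z) =
      mvfderiv I (fun y => (trivializationAt F V x ⟨y, σ y⟩).2) x Z := by
  have b := Module.finBasis ℝ F
  rw [covariantDerivative_eq_sum hcov b hσ,
    covariantDerivative_eq_sum hcov b (mdifferentiableAt_extend I F (σ x)), extend_apply_self,
    mvfderiv_trivializationAt_extend, zero_apply, map_zero, zero_add, add_sub_cancel_right,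
    ContinuousLinearEquiv.apply_symm_apply]

end CovariantDerivative

section Splitting

variable [FiniteDimensional ℝ E] [FiniteDimensional ℝ F] [IsManifold I 1 M]
  [ContMDiffVectorBundle 1 F V I]

theorem fibreCoordDeriv_verticalLift (q : TotalSpace F V) (β : V q.proj) :
    fibreCoordDeriv I q (verticalLift I q β) = fibreCoord F q.proj β := by
  have hcoord : HasMFDerivAt (I.prod 𝓘(ℝ, F)) 𝓘(ℝ, F)
      (fun z : TotalSpace F V => (trivializationAt F V q.proj z).2) (fibreLine q β 0)
      (fibreCoordDeriv I q) := by
    rw [fibreLine_zero]; exact hasMFDerivAt_fibreCoord q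
  have hline := hcoord.comp (0 : ℝ) (mdifferentiable_fibreLine (I := I) q β 0).hasMFDerivAt
  have haffine : HasDerivAt (fun t : ℝ => fibreCoord F q.proj q.2 + t • fibreCoord F q.proj β)
      (fibreCoord F q.proj β) 0 := by
    simpa using ((hasDerivAt_id (0 : ℝ)).smul_const (fibreCoord F q.proj β)).const_add
      (fibreCoord F q.proj q.2)
  have heq : ((fun z : TotalSpace F V => (trivializationAt F V q.proj z).2) ∘ fibreLine q β) =
      fun t : ℝ => fibreCoord F q.proj q.2 + t • fibreCoord F q.proj β := by
    rw [fibreLine_eq]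
    exact funext fun t => trivializationAt_fibreIncl _ _
  rw [heq] at hline
  exact (congrArg (fun L => L (1 : ℝ))
    (hasMFDerivAt_unique hline haffine.hasFDerivAt.hasMFDerivAt)).trans (one_smul ℝ _)

theorem fibreCoordDeriv_horizontalLift
    (nablaV : (σ : (x : M) → V x) → (x : M) → TangentSpace I x →ₗ[ℝ] V x)
    (q : TotalSpace F V) (X : TangentSpace I q.proj) :
    fibreCoordDeriv I q (horizontalLift nablaV q X) =
      -fibreCoord F q.proj (nablaV (extend F q.2) q.proj X) := by
  rw [horizontalLift, LinearMap.sub_apply, map_sub, LinearMap.comp_apply,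
    fibreCoordDeriv_verticalLift, ContinuousLinearMap.coe_coe, fibreCoordDeriv_extendDeriv,
    zero_sub]

theorem ext_projVec_fibreCoordDeriv {q : TotalSpace F V}
    {w w' : TangentSpace (I.prod 𝓘(ℝ, F)) q} (hproj : projVec I q w = projVec I q w')
    (hcoord : fibreCoordDeriv I q w = fibreCoordDeriv I q w') : w = w' := by
  obtain ⟨⟨X, β⟩, hu⟩ := (tangentSplitting (fun _ _ => 0) q).surjective (w - w')
  have hX : X = 0 := by
    have h := congrArg (projVec I q) hu
    rwa [tangentSplitting_apply, map_add, projVec_horizontalLift, projVec_verticalLift, add_zero,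
      map_sub, hproj, sub_self] at h
  have hβ : β = 0 := by
    have h := congrArg (fibreCoordDeriv I q) hu
    rw [tangentSplitting_apply, hX, map_zero, zero_add, fibreCoordDeriv_verticalLift, map_sub,
      hcoord, sub_self] at h
    exact (fibreCoord F q.proj).map_eq_zero_iff.1 h
  rw [← sub_eq_zero, ← hu, hX, hβ]
  exact map_zero _

variable [∀ x, IsTopologicalAddGroup (V x)] [∀ x, ContinuousSMul ℝ (V x)]

theorem mfderiv_section_eq_horizontalLift_add_verticalLift
    {cov : (σ : (x : M) → V x) → (x : M) → TangentSpace I x →L[ℝ] V x}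
    (hcov : IsCovariantDerivativeOn F cov) {σ : (y : M) → V y} {x : M}
    (hσ : MDifferentiableAt I (I.prod 𝓘(ℝ, F)) (fun y => TotalSpace.mk' F y (σ y)) x)
    (Z : TangentSpace I x) :
    mfderiv I (I.prod 𝓘(ℝ, F)) (fun y => TotalSpace.mk' F y (σ y)) x Z =
      horizontalLift (fun τ y => (cov τ y).toLinearMap) (TotalSpace.mk' F x (σ x)) Z +
        verticalLift I (TotalSpace.mk' F x (σ x)) (cov σ x Z) := by
  apply ext_projVec_fibreCoordDeriv
  · rw [projVec_mfderiv_section hσ, map_add, projVec_horizontalLift, projVec_verticalLift, add_zero]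
  · rw [fibreCoordDeriv_mfderiv_section hσ rfl, map_add, fibreCoordDeriv_horizontalLift,
      fibreCoordDeriv_verticalLift, ← fibreCoord_covariantDerivative_sub_extend hcov hσ, map_sub,
      neg_add_eq_sub]
    rfl

end Splitting

end Sections

/-! ### The covariant derivative of `L²`-valued bilinear forms -/

section Manifold4

variable {M : Type*} [TopologicalSpace M] [ChartedSpace E4 M] [IsManifold (𝓡 4) ∞ M]

section BilinearForms

variable (nabla : CovariantDerivative (𝓡 4) E4 (TangentSpace (𝓡 4) : M → Type))
  (D : CovariantDerivative (𝓡 4) ℝ (Density (M := M) 1))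

theorem bilinCov_apply {B : (y : M) → WForm y} {x : M} (hB : MDiffForm B x)
    (Z : TangentSpace (𝓡 4) x) {X Y : (y : M) → TangentSpace (𝓡 4) y}
    (hX : MDiffField X x) (hY : MDiffField Y x) :
    bilinCov nabla D B x Z (X x) (Y x) = bilinCovAux nabla D B x Z X Y := by
  rw [bilinCov, dif_pos hB]
  exact TensorialAt.mkHom₂_apply
    (fun Y hY => bilinCovAux_tensorial_left nabla D hB Z Y hY)
    (fun X hX => bilinCovAux_tensorial_right nabla D hB Z X hX) hX hY

theorem mdiffField_extend {x : M} (v : TangentSpace (𝓡 4) x) : MDiffField (extend E4 v) x :=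
  mdifferentiableAt_extend (𝓡 4) E4 v

theorem bilinCov_apply_extend {B : (y : M) → WForm y} {x : M} (hB : MDiffForm B x)
    (Z v w : TangentSpace (𝓡 4) x) :
    bilinCov nabla D B x Z v w = bilinCovAux nabla D B x Z (extend E4 v) (extend E4 w) := by
  rw [← bilinCov_apply nabla D hB Z (mdiffField_extend v) (mdiffField_extend w),
    extend_apply_self, extend_apply_self]

theorem bilinCov_add {B B' : (y : M) → WForm y} {x : M} (hB : MDiffForm B x)
    (hB' : MDiffForm B' x) (Z v w : TangentSpace (𝓡 4) x) :
    bilinCov nabla D (B + B') x Z v w =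
      bilinCov nabla D B x Z v w + bilinCov nabla D B' x Z v w := by
  have hsq := (squareConnection D).isCovariantDerivativeOnUniv.add
    (hB.clm_bundle_apply₂ (mdiffField_extend v) (mdiffField_extend w))
    (hB'.clm_bundle_apply₂ (mdiffField_extend v) (mdiffField_extend w))
  have hval : (fun y => (B + B') y (extend E4 v y) (extend E4 w y)) =
    (fun y => B y (extend E4 v y) (extend E4 w y)) +
      fun y => B' y (extend E4 v y) (extend E4 w y) := rfl
  rw [bilinCov_apply_extend nabla D hB, bilinCov_apply_extend nabla D hB',
    bilinCov_apply_extend nabla D (mdifferentiableAt_add_section hB hB')]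
  simp only [bilinCovAux]
  rw [hval, hsq]
  simp only [add_apply, Pi.add_apply]
  abel

theorem bilinCov_smul {g : M → ℝ} {B : (y : M) → WForm y} {x : M}
    (hg : MDifferentiableAt (𝓡 4) 𝓘(ℝ, ℝ) g x) (hB : MDiffForm B x)
    (Z v w : TangentSpace (𝓡 4) x) :
    bilinCov nabla D (g • B) x Z v w =
      g x • bilinCov nabla D B x Z v w + mvfderiv (𝓡 4) g x Z • B x v w := by
  have hsq := (squareConnection D).isCovariantDerivativeOnUniv.leibniz
    (hB.clm_bundle_apply₂ (mdiffField_extend v) (mdiffField_extend w)) hg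
  have hval : (fun y => (g • B) y (extend E4 v y) (extend E4 w y)) =
    g • fun y => B y (extend E4 v y) (extend E4 w y) := rfl
  have hsmul : MDiffForm (g • B) x :=
    MDifferentiableAt.smul_section (F := BilinForm4) (E := WForm) hg hB
  rw [bilinCov_apply_extend nabla D hB, bilinCov_apply_extend nabla D hsmul]
  simp only [bilinCovAux]
  rw [hval, hsq]
  simp only [add_apply, smul_apply, Pi.smul_apply', extend_apply_self,
    ContinuousLinearMap.smulRight_apply]
  module

/-- `bilinCov` with its values bundled as continuous linear maps, as `IsCovariantDerivativeOn`
requires. -/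
noncomputable def bilinCovL (B : (y : M) → WForm y) (x : M) :
    TangentSpace (𝓡 4) x →L[ℝ] WForm x :=
  haveI : FiniteDimensional ℝ (TangentSpace (𝓡 4) x) := inferInstanceAs (FiniteDimensional ℝ E4)
  haveI : T2Space (TangentSpace (𝓡 4) x) := inferInstanceAs (T2Space E4)
  LinearMap.toContinuousLinearMap (bilinCov nabla D B x)

theorem isCovariantDerivativeOn_bilinCovL :
    IsCovariantDerivativeOn BilinForm4 (bilinCovL nabla D) where
  add hB hB' _ := by
    ext Z v w
    exact bilinCov_add nabla D hB hB' Z v w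
  leibniz hB hg _ := by
    ext Z v w
    exact bilinCov_smul nabla D hg hB Z v w

theorem mfderiv_form_section {B : (y : M) → WForm y} {x : M} (hB : MDiffForm B x)
    (Z : TangentSpace (𝓡 4) x) :
    mfderiv (𝓡 4) FormModel (fun y => TotalSpace.mk' BilinForm4 y (B y)) x Z =
      horizontalLift (bilinCov nabla D) (TotalSpace.mk' BilinForm4 x (B x)) Z +
        verticalLift (𝓡 4) (TotalSpace.mk' BilinForm4 x (B x)) (bilinCov nabla D B x Z) :=
  mfderiv_section_eq_horizontalLift_add_verticalLift
    (isCovariantDerivativeOn_bilinCovL nabla D) hB Z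

end BilinearForms


/-! ### Covariant derivatives of 2-forms -/

theorem IsTwoForm.swap {x : M} {β : WForm x} (hβ : IsTwoForm β) (v w : TangentSpace (𝓡 4) x) :
    β v w = -β w v := by
  have h := hβ (v + w)
  rw [map_add, map_add, add_apply, add_apply, hβ v, hβ w, zero_add, add_zero] at h
  exact eq_neg_of_add_eq_zero_right h

theorem squareConnection_zero (D : CovariantDerivative (𝓡 4) ℝ (Density (M := M) 1)) (x : M) :
    squareConnection D (fun _ => 0) x = 0 :=
  (squareConnection D).isCovariantDerivativeOnUniv.zero

theorem isTwoForm_bilinCov (nabla : CovariantDerivative (𝓡 4) E4 (TangentSpace (𝓡 4) : M → Type))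
    (D : CovariantDerivative (𝓡 4) ℝ (Density (M := M) 1)) {B : (y : M) → WForm y} {x : M}
    (hB : MDiffForm B x) (hB₂ : ∀ y, IsTwoForm (B y)) (Z : TangentSpace (𝓡 4) x) :
    IsTwoForm (bilinCov nabla D B x Z) := by
  intro v
  have hdiag : (fun y => B y (extend E4 v y) (extend E4 v y)) = fun _ => 0 :=
    funext fun y => hB₂ y _
  rw [bilinCov_apply_extend nabla D hB, bilinCovAux, hdiag, squareConnection_zero,
    (hB₂ x).swap (extend E4 v x), zero_apply]
  abel

theorem bilinCov_cyclic_eq_extCov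
    {nabla : CovariantDerivative (𝓡 4) E4 (TangentSpace (𝓡 4) : M → Type)}
    (htorsion : nabla.torsion = 0) (D : CovariantDerivative (𝓡 4) ℝ (Density (M := M) 1))
    {B : (y : M) → WForm y} {x : M} (hB : MDiffForm B x) (hB₂ : ∀ y, IsTwoForm (B y))
    (u v w : TangentSpace (𝓡 4) x) :
    bilinCov nabla D B x u v w + bilinCov nabla D B x v w u + bilinCov nabla D B x w u v =
      extCov D B (extend E4 u) (extend E4 v) (extend E4 w) x := by
  have hbracket (a b : TangentSpace (𝓡 4) x) :=
    nabla.torsion_eq_zero_iff.1 htorsion (mdiffField_extend a) (mdiffField_extend b)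
  rw [(isTwoForm_bilinCov nabla D hB hB₂ v).swap w u]
  simp only [bilinCov_apply_extend nabla D hB, bilinCovAux, extCov, ← hbracket,
    extend_apply_self, map_sub, sub_apply]
  rw [(hB₂ x).swap v (nabla _ x u), (hB₂ x).swap u (nabla _ x v), (hB₂ x).swap u (nabla _ x w)]
  abel

-- Sum the four cyclic identities for `(Ja, b, d)`, `(a, Jb, d)`, `(a, b, Jd)`, `(Ja, Jb, Jd)`.
theorem apply_map_eq_of_cyclic {V W : Type*} [AddCommGroup W] [IsAddTorsionFree W]
    {J : V → V} {T : V → V → V → W} (hanti : ∀ a b d, T a (J b) (J d) = -T a b d)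
    (hsymm : ∀ a b d, T a b (J d) = T a (J b) d)
    (hcyclic : ∀ a b d, T a b d + T b d a + T d a b = 0) (a b d : V) :
    T (J a) b d = T a (J b) d := by
  have hJa := hcyclic (J a) b d
  have hJb := hcyclic a (J b) d
  have hJd := hcyclic a b (J d)
  have hJJJ := hcyclic (J a) (J b) (J d)
  simp only [hanti] at hJJJ
  simp only [hsymm] at hJa hJb hJd
  have htwice : 2 • T (J a) b d = 2 • T a (J b) d := by
    rw [← sub_eq_zero]
    calc 2 • T (J a) b d - 2 • T a (J b) d
        = (T (J a) b d + T b (J d) a + T d (J a) b)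
          - (-T (J a) b d + -T (J b) d a + -T (J d) a b)
          - (T a (J b) d + T (J b) d a + T d (J a) b)
          - (T a (J b) d + T b (J d) a + T (J d) a b) := by abel
      _ = 0 := by rw [hJa, hJb, hJd, hJJJ]; simp
  exact nsmul_right_injective two_ne_zero htwice

end Manifold4

/-! ### The conformal Kähler form -/

theorem contMDiff_clm_bundle_comp
    {EB : Type*} [NormedAddCommGroup EB] [NormedSpace ℝ EB]
    {HB : Type*} [TopologicalSpace HB] {IB : ModelWithCorners ℝ EB HB}
    {B : Type*} [TopologicalSpace B] [ChartedSpace HB B] {n : WithTop ℕ∞}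
    {F₁ F₂ F₃ : Type*} [NormedAddCommGroup F₁] [NormedSpace ℝ F₁]
    [NormedAddCommGroup F₂] [NormedSpace ℝ F₂] [NormedAddCommGroup F₃] [NormedSpace ℝ F₃]
    {V₁ V₂ V₃ : B → Type*}
    [TopologicalSpace (TotalSpace F₁ V₁)] [∀ x, AddCommGroup (V₁ x)] [∀ x, Module ℝ (V₁ x)]
    [∀ x, TopologicalSpace (V₁ x)] [FiberBundle F₁ V₁] [VectorBundle ℝ F₁ V₁]
    [TopologicalSpace (TotalSpace F₂ V₂)] [∀ x, AddCommGroup (V₂ x)] [∀ x, Module ℝ (V₂ x)]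
    [∀ x, TopologicalSpace (V₂ x)] [FiberBundle F₂ V₂] [VectorBundle ℝ F₂ V₂]
    [∀ x, IsTopologicalAddGroup (V₂ x)] [∀ x, ContinuousSMul ℝ (V₂ x)]
    [TopologicalSpace (TotalSpace F₃ V₃)] [∀ x, AddCommGroup (V₃ x)] [∀ x, Module ℝ (V₃ x)]
    [∀ x, TopologicalSpace (V₃ x)] [FiberBundle F₃ V₃] [VectorBundle ℝ F₃ V₃]
    [∀ x, IsTopologicalAddGroup (V₃ x)] [∀ x, ContinuousSMul ℝ (V₃ x)]
    {ψ : (x : B) → V₂ x →L[ℝ] V₃ x} {φ : (x : B) → V₁ x →L[ℝ] V₂ x}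
    (hψ : ContMDiff IB (IB.prod 𝓘(ℝ, F₂ →L[ℝ] F₃)) n
      (fun x => TotalSpace.mk' (F₂ →L[ℝ] F₃) (E := fun x => V₂ x →L[ℝ] V₃ x) x (ψ x)))
    (hφ : ContMDiff IB (IB.prod 𝓘(ℝ, F₁ →L[ℝ] F₂)) n
      (fun x => TotalSpace.mk' (F₁ →L[ℝ] F₂) (E := fun x => V₁ x →L[ℝ] V₂ x) x (φ x))) :
    ContMDiff IB (IB.prod 𝓘(ℝ, F₁ →L[ℝ] F₃)) n
      (fun x => TotalSpace.mk' (F₁ →L[ℝ] F₃) (E := fun x => V₁ x →L[ℝ] V₃ x) x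
        ((ψ x).comp (φ x))) := by
  intro x
  have h1 := (contMDiffAt_hom_bundle _).1 (hψ x)
  have h2 := (contMDiffAt_hom_bundle _).1 (hφ x)
  refine (contMDiffAt_hom_bundle _).2 ⟨h1.1, (h1.2.clm_comp h2.2).congr_of_eventuallyEq ?_⟩
  filter_upwards [(trivializationAt F₂ V₂ x).open_baseSet.mem_nhds
    (mem_baseSet_trivializationAt F₂ V₂ x)] with y hy
  ext v
  simp only [ContinuousLinearMap.inCoordinates, ContinuousLinearMap.comp_apply,
    Trivialization.symmL_continuousLinearMapAt _ hy]

section Manifold4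

variable {M : Type*} [TopologicalSpace M] [ChartedSpace E4 M] [IsManifold (𝓡 4) ∞ M]
  {c : ConformalMetric M} {J : AlmostComplexStructure M}
  {nabla : CovariantDerivative (𝓡 4) E4 (TangentSpace (𝓡 4) : M → Type)}
  {D : CovariantDerivative (𝓡 4) ℝ (Density (M := M) 1)}

theorem contMDiff_kaehlerForm (c : ConformalMetric M) (J : AlmostComplexStructure M) :
    ContMDiff (𝓡 4) FormModel ∞
      (fun x => TotalSpace.mk' BilinForm4 x (kaehlerForm c J x)) :=
  contMDiff_clm_bundle_comp (V₃ := fun x : M => TangentSpace (𝓡 4) x →L[ℝ] Density 2 x)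
    c.smooth J.smooth

theorem mdiffForm_kaehlerForm (c : ConformalMetric M) (J : AlmostComplexStructure M) (x : M) :
    MDiffForm (kaehlerForm c J) x :=
  (contMDiff_kaehlerForm c J).mdifferentiable (by simp) x

theorem mdiffForm_metric (c : ConformalMetric M) (x : M) : MDiffForm c.form x :=
  c.smooth.mdifferentiable (by simp) x

theorem AlmostComplexStructure.mdiffField (J : AlmostComplexStructure M) {x : M}
    {X : (y : M) → TangentSpace (𝓡 4) y} (hX : MDiffField X x) :
    MDiffField (fun y => J.toFun y (X y)) x :=
  (J.smooth.mdifferentiable (by simp) x).clm_bundle_apply hX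

theorem kaehlerForm_apply (c : ConformalMetric M) (J : AlmostComplexStructure M) (x : M)
    (v w : TangentSpace (𝓡 4) x) : kaehlerForm c J x v w = c.form x (J.toFun x v) w := rfl

theorem isTwoForm_kaehlerForm (hcJ : IsConformallyAlmostHermitian c J) (x : M) :
    IsTwoForm (kaehlerForm c J x) := by
  intro v
  have : IsAddTorsionFree (Density 2 x) := inferInstanceAs (IsAddTorsionFree ℝ)
  have hneg : kaehlerForm c J x v v = -kaehlerForm c J x v v :=
    calc c.form x (J.toFun x v) v
        = c.form x (J.toFun x (J.toFun x v)) (J.toFun x v) := hcJ x _ v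
      _ = -c.form x (J.toFun x v) v := by rw [J.sq, map_neg, neg_apply, c.symm x v]
  exact self_eq_neg.1 hneg

/-! ### The covariant derivative of the Kähler form -/

theorem bilinCov_kaehlerForm_apply (hnabla : IsWeylConnection c D nabla) {x : M}
    (Z : TangentSpace (𝓡 4) x) {X : (y : M) → TangentSpace (𝓡 4) y} (hX : MDiffField X x)
    (w : TangentSpace (𝓡 4) x) :
    bilinCov nabla D (kaehlerForm c J) x Z (X x) w =
      c.form x (nabla (fun y => J.toFun y (X y)) x Z - J.toFun x (nabla X x Z)) w := by
  have hω := bilinCov_apply nabla D (mdiffForm_kaehlerForm c J x) Z hX (mdiffField_extend w)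
  have hparallel :=
    bilinCov_apply nabla D (mdiffForm_metric c x) Z (J.mdiffField hX) (mdiffField_extend w)
  rw [hnabla.2 x, eq_comm, bilinCovAux, extend_apply_self, sub_sub] at hparallel
  simp only [LinearMap.zero_apply, zero_apply, sub_eq_zero] at hparallel
  rw [bilinCovAux, extend_apply_self] at hω
  simp only [kaehlerForm_apply] at hω
  rw [hω, hparallel, map_sub, sub_apply]
  abel

theorem covariantDerivative_J_J
    (nabla : CovariantDerivative (𝓡 4) E4 (TangentSpace (𝓡 4) : M → Type))
    (J : AlmostComplexStructure M) {x : M}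
    (Z : TangentSpace (𝓡 4) x) {X : (y : M) → TangentSpace (𝓡 4) y} (hX : MDiffField X x) :
    nabla (fun y => J.toFun y (J.toFun y (X y))) x Z = -nabla X x Z := by
  have hsq : (fun y => J.toFun y (J.toFun y (X y))) = (-1 : ℝ) • X := by
    funext y
    rw [J.sq, Pi.smul_apply, neg_one_smul]
  rw [hsq, nabla.isCovariantDerivativeOnUniv.smul_const (-1) hX]
  simp

theorem bilinCov_kaehlerForm_J_J (hcJ : IsConformallyAlmostHermitian c J)
    (hnabla : IsWeylConnection c D nabla) {x : M} (Z v w : TangentSpace (𝓡 4) x) :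
    bilinCov nabla D (kaehlerForm c J) x Z (J.toFun x v) (J.toFun x w) =
      -bilinCov nabla D (kaehlerForm c J) x Z v w := by
  have hv := mdiffField_extend v
  have hωv := bilinCov_kaehlerForm_apply (J := J) hnabla Z hv w
  have hωJv := bilinCov_kaehlerForm_apply (J := J) hnabla Z (J.mdiffField hv) (J.toFun x w)
  rw [extend_apply_self] at hωv hωJv
  have hdefect : -nabla (extend E4 v) x Z -
        J.toFun x (nabla (fun y => J.toFun y (extend E4 v y)) x Z) =
      -J.toFun x (nabla (fun y => J.toFun y (extend E4 v y)) x Z -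
        J.toFun x (nabla (extend E4 v) x Z)) := by
    rw [map_sub, J.sq]
    abel
  rw [hωv, hωJv, covariantDerivative_J_J nabla J Z hv, hdefect, map_neg, neg_apply, ← hcJ]

theorem bilinCov_kaehlerForm_J_right (hcJ : IsConformallyAlmostHermitian c J)
    (hnabla : IsWeylConnection c D nabla) {x : M} (Z v w : TangentSpace (𝓡 4) x) :
    bilinCov nabla D (kaehlerForm c J) x Z v (J.toFun x w) =
      bilinCov nabla D (kaehlerForm c J) x Z (J.toFun x v) w := by
  have h := bilinCov_kaehlerForm_J_J hcJ hnabla Z v (J.toFun x w)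
  rw [J.sq, map_neg, neg_inj] at h
  exact h.symm

theorem bilinCov_kaehlerForm_cyclic (hcJ : IsConformallyAlmostHermitian c J)
    (hD : IsCanonicalWeylDerivative c J D) (hnabla : IsWeylConnection c D nabla) {x : M}
    (u v w : TangentSpace (𝓡 4) x) :
    bilinCov nabla D (kaehlerForm c J) x u v w + bilinCov nabla D (kaehlerForm c J) x v w u +
      bilinCov nabla D (kaehlerForm c J) x w u v = 0 := by
  rw [bilinCov_cyclic_eq_extCov hnabla.1 D (mdiffForm_kaehlerForm c J x)
    (isTwoForm_kaehlerForm hcJ)]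
  exact hD x _ _ _ (mdiffField_extend u) (mdiffField_extend v) (mdiffField_extend w)

theorem bilinCov_kaehlerForm_J (hcJ : IsConformallyAlmostHermitian c J)
    (hD : IsCanonicalWeylDerivative c J D) (hnabla : IsWeylConnection c D nabla) {x : M}
    (Z : TangentSpace (𝓡 4) x) :
    bilinCov nabla D (kaehlerForm c J) x (J.toFun x Z) =
      formAct (J.toFun x) (bilinCov nabla D (kaehlerForm c J) x Z) := by
  ext v w
  have : IsAddTorsionFree (Density 2 x) := inferInstanceAs (IsAddTorsionFree ℝ)
  exact apply_map_eq_of_cyclic (T := fun u v w => bilinCov nabla D (kaehlerForm c J) x u v w)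
    (bilinCov_kaehlerForm_J_J hcJ hnabla) (bilinCov_kaehlerForm_J_right hcJ hnabla)
    (bilinCov_kaehlerForm_cyclic hcJ hD hnabla) Z v w

end Manifold4

/-! ### Pfaffians of orthogonal complex structures -/

section Pfaffian

open scoped Matrix

variable {R : Type*} [CommRing R]

/-- The Pfaffian of an alternating `4 × 4` matrix, read off its entries above the diagonal. -/
def pfaffian (A : Matrix (Fin 4) (Fin 4) R) : R :=
  A 0 1 * A 2 3 - A 0 2 * A 1 3 + A 0 3 * A 1 2

/-- The Hodge star on alternating `4 × 4` matrices, read off the entries above the diagonal: it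
exchanges the entries at `01` and `23`, at `03` and `12`, and, up to sign, at `02` and `13`. -/
def hodgeDual (A : Matrix (Fin 4) (Fin 4) R) : Matrix (Fin 4) (Fin 4) R :=
  !![0, A 2 3, -A 1 3, A 1 2;
    -A 2 3, 0, A 0 3, -A 0 2;
    A 1 3, -A 0 3, 0, A 0 1;
    -A 1 2, A 0 2, -A 0 1, 0]

theorem eq_of_transpose_eq_neg {A : Matrix (Fin 4) (Fin 4) R} (hA : Aᵀ = -A)
    (hdiag : ∀ i, A i i = 0) :
    A = !![0, A 0 1, A 0 2, A 0 3;
      -A 0 1, 0, A 1 2, A 1 3;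
      -A 0 2, -A 1 2, 0, A 2 3;
      -A 0 3, -A 1 3, -A 2 3, 0] := by
  have hswap (i j : Fin 4) : A j i = -A i j := congrFun₂ hA i j
  ext i j
  fin_cases i <;> fin_cases j <;> first | exact hdiag _ | exact hswap _ _ | rfl

theorem mul_hodgeDual {A : Matrix (Fin 4) (Fin 4) R} (hA : Aᵀ = -A) (hdiag : ∀ i, A i i = 0) :
    A * hodgeDual A = -pfaffian A • 1 := by
  rw [eq_of_transpose_eq_neg hA hdiag]
  ext i j
  fin_cases i <;> fin_cases j <;>
    simp [hodgeDual, pfaffian, Matrix.mul_apply, Fin.sum_univ_four] <;> ring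

theorem hodgeDual_smul (r : R) (A : Matrix (Fin 4) (Fin 4) R) :
    hodgeDual (r • A) = r • hodgeDual A := by
  simp [hodgeDual]

theorem hodgeDual_hodgeDual {A : Matrix (Fin 4) (Fin 4) R} (hA : Aᵀ = -A)
    (hdiag : ∀ i, A i i = 0) : hodgeDual (hodgeDual A) = A := by
  rw [eq_of_transpose_eq_neg hA hdiag]
  simp [hodgeDual]

theorem hodgeDual_eq_pfaffian_smul {A : Matrix (Fin 4) (Fin 4) R} (hA : Aᵀ = -A)
    (hdiag : ∀ i, A i i = 0) (hsq : A * A = -1) : hodgeDual A = pfaffian A • A :=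
  calc hodgeDual A = -(A * A) * hodgeDual A := by rw [hsq, neg_neg, one_mul]
    _ = -(A * (A * hodgeDual A)) := by rw [neg_mul, mul_assoc]
    _ = pfaffian A • A := by simp [mul_hodgeDual hA hdiag]

theorem pfaffian_mul_self {A : Matrix (Fin 4) (Fin 4) R} (hA : Aᵀ = -A)
    (hdiag : ∀ i, A i i = 0) (hsq : A * A = -1) : pfaffian A * pfaffian A = 1 := by
  have hfix : (pfaffian A * pfaffian A) • A = A :=
    calc (pfaffian A * pfaffian A) • A = hodgeDual (hodgeDual A) := by
          rw [hodgeDual_eq_pfaffian_smul hA hdiag hsq, hodgeDual_smul,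
            hodgeDual_eq_pfaffian_smul hA hdiag hsq, smul_smul]
      _ = A := hodgeDual_hodgeDual hA hdiag
  have hone := congrArg (fun B => (B * A) 0 0) hfix
  simpa [hsq] using hone

theorem sum_det_complexFrame {V : Type*} [AddCommGroup V] [Module R V]
    (e : Module.Basis (Fin 4) R V) {f : V → V} {A : Matrix (Fin 4) (Fin 4) R}
    (hf : ∀ i j, e.repr (f (e i)) j = A i j) (hA : Aᵀ = -A) (hdiag : ∀ i, A i i = 0) :
    ∑ k, e.det ![e 0, f (e 0), e k, f (e k)] = 2 * pfaffian A := by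
  rw [eq_of_transpose_eq_neg hA hdiag] at hf
  simp [Module.Basis.det_apply, Matrix.det_succ_column_zero, Fin.sum_univ_succ,
    Module.Basis.toMatrix_apply, hf, pfaffian]
  ring

end Pfaffian

/-! ### Self-duality of the conformal Kähler form -/

section Manifold4

variable {M : Type*} [TopologicalSpace M] [ChartedSpace E4 M] [IsManifold (𝓡 4) ∞ M]

section FrameMatrix

variable {x : M} (e : Module.Basis (Fin 4) ℝ (TangentSpace (𝓡 4) x)) (m : Density 2 x)

/-- The weightless components of an `L²`-valued bilinear form in a frame, as a matrix. -/
noncomputable def frameMatrix (β : WForm x) : Matrix (Fin 4) (Fin 4) ℝ :=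
  Matrix.of (frameCoeff e m β)

theorem frameMatrix_transpose {β : WForm x} (hβ : IsTwoForm β) :
    (frameMatrix e m β).transpose = -frameMatrix e m β := by
  ext i j
  change densityCoord (β (e j) (e i)) / _ = -(densityCoord (β (e i) (e j)) / _)
  rw [hβ.swap (e j)]
  exact neg_div _ _

theorem frameMatrix_diag {β : WForm x} (hβ : IsTwoForm β) (i : Fin 4) :
    frameMatrix e m β i i = 0 := by
  change densityCoord (β (e i) (e i)) / _ = 0
  rw [hβ]
  exact zero_div _

theorem formWedge_eq_sum_mul_hodgeDual (β γ : WForm x) :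
    formWedge e m β γ =
      ∑ i, ∑ j ∈ Finset.Ioi i, frameCoeff e m β i j * hodgeDual (frameMatrix e m γ) i j := by
  have hIoi₀ : Finset.Ioi (0 : Fin 4) = {1, 2, 3} := by decide
  have hIoi₁ : Finset.Ioi (1 : Fin 4) = {2, 3} := by decide
  have hIoi₂ : Finset.Ioi (2 : Fin 4) = {3} := by decide
  have hIoi₃ : Finset.Ioi (3 : Fin 4) = ∅ := by decide
  simp [formWedge, hodgeDual, frameMatrix, Fin.sum_univ_four, hIoi₀, hIoi₁, hIoi₂, hIoi₃]
  ring

theorem formWedge_eq_formInner (β : WForm x) {γ : WForm x}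
    (hγ : hodgeDual (frameMatrix e m γ) = frameMatrix e m γ) :
    formWedge e m β γ = formInner e m β γ := by
  rw [formWedge_eq_sum_mul_hodgeDual, hγ]
  rfl

theorem formWedge_self (β : WForm x) :
    formWedge e m β β = 2 * pfaffian (frameMatrix e m β) := by
  simp only [formWedge, pfaffian, frameMatrix, Matrix.of_apply]
  ring

end FrameMatrix

variable {c : ConformalMetric M} {J : AlmostComplexStructure M}
  {o : (x : M) → Orientation ℝ (TangentSpace (𝓡 4) x) (Fin 4)}

namespace IsConformalFrame

variable {x : M} {e : Module.Basis (Fin 4) ℝ (TangentSpace (𝓡 4) x)} {m : Density 2 x}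

theorem scale_pos (he : IsConformalFrame c o x e m) : 0 < densityCoord m := by
  have h := c.pos x (e 0) (e.ne_zero 0)
  rwa [he.orthogonal, if_pos rfl] at h

theorem metric_eq_repr_smul (he : IsConformalFrame c o x e m) (v : TangentSpace (𝓡 4) x)
    (j : Fin 4) : c.form x v (e j) = e.repr v j • m := by
  have h : c.form x (∑ i, e.repr v i • e i) (e j) = e.repr v j • m := by
    rw [map_sum, sum_apply]
    simp [he.orthogonal]
  rwa [e.sum_repr] at h

theorem repr_J (he : IsConformalFrame c o x e m) (i j : Fin 4) :
    e.repr (J.toFun x (e i)) j = frameMatrix e m (kaehlerForm c J x) i j := by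
  rw [frameMatrix, Matrix.of_apply, frameCoeff, kaehlerForm_apply, he.metric_eq_repr_smul]
  exact (mul_div_cancel_right₀ _ he.scale_pos.ne').symm

theorem frameMatrix_kaehlerForm_mul_self (he : IsConformalFrame c o x e m) :
    frameMatrix e m (kaehlerForm c J x) * frameMatrix e m (kaehlerForm c J x) = -1 := by
  have htranspose : frameMatrix e m (kaehlerForm c J x) =
      (LinearMap.toMatrix e e (J.toFun x).toLinearMap).transpose := by
    ext i j
    rw [← he.repr_J, Matrix.transpose_apply, LinearMap.toMatrix_apply]
    rfl
  have hsq : (J.toFun x).toLinearMap * (J.toFun x).toLinearMap = -1 := LinearMap.ext (J.sq x)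
  rw [htranspose, ← Matrix.transpose_mul, ← LinearMap.toMatrix_mul, hsq, map_neg,
    LinearMap.toMatrix_one, Matrix.transpose_neg, Matrix.transpose_one]

theorem det_complexFrame_nonneg (he : IsConformalFrame c o x e m) (ho : IsComplexOrientation J o)
    (u v : TangentSpace (𝓡 4) x) : 0 ≤ e.det ![u, J.toFun x u, v, J.toFun x v] := by
  by_cases hdet : e.det ![u, J.toFun x u, v, J.toFun x v] = 0
  · exact hdet.ge
  obtain ⟨hli, hsp⟩ := e.is_basis_iff_det.2 (isUnit_iff_ne_zero.2 hdet)
  have hb : ⇑(Module.Basis.mk hli hsp.ge) = ![u, J.toFun x u, v, J.toFun x v] :=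
    Module.Basis.coe_mk hli hsp.ge
  have horient := ho x (Module.Basis.mk hli hsp.ge) (by rw [hb]; rfl) (by rw [hb]; rfl)
  have hpos := (e.orientation_eq_iff_det_pos _).1 (he.positive.trans horient.symm)
  rw [hb] at hpos
  exact hpos.le

theorem pfaffian_kaehlerForm (he : IsConformalFrame c o x e m)
    (hcJ : IsConformallyAlmostHermitian c J) (ho : IsComplexOrientation J o) :
    pfaffian (frameMatrix e m (kaehlerForm c J x)) = 1 := by
  have hω := isTwoForm_kaehlerForm hcJ x
  have hsq := pfaffian_mul_self (frameMatrix_transpose e m hω) (frameMatrix_diag e m hω)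
    he.frameMatrix_kaehlerForm_mul_self
  have hsum := sum_det_complexFrame e he.repr_J (frameMatrix_transpose e m hω)
    (frameMatrix_diag e m hω)
  have hnonneg : 0 ≤ ∑ k, e.det ![e 0, J.toFun x (e 0), e k, J.toFun x (e k)] :=
    Finset.sum_nonneg fun k _ => he.det_complexFrame_nonneg ho (e 0) (e k)
  rcases mul_self_eq_one_iff.1 hsq with h | h
  · exact h
  · linarith

theorem hodgeDual_kaehlerForm (he : IsConformalFrame c o x e m)
    (hcJ : IsConformallyAlmostHermitian c J) (ho : IsComplexOrientation J o) :
    hodgeDual (frameMatrix e m (kaehlerForm c J x)) = frameMatrix e m (kaehlerForm c J x) := by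
  have hω := isTwoForm_kaehlerForm hcJ x
  rw [hodgeDual_eq_pfaffian_smul (frameMatrix_transpose e m hω) (frameMatrix_diag e m hω)
    he.frameMatrix_kaehlerForm_mul_self, he.pfaffian_kaehlerForm hcJ ho, one_smul]

theorem formWedge_kaehlerForm (he : IsConformalFrame c o x e m)
    (hcJ : IsConformallyAlmostHermitian c J) (ho : IsComplexOrientation J o) (β : WForm x) :
    formWedge e m β (kaehlerForm c J x) = formInner e m β (kaehlerForm c J x) :=
  formWedge_eq_formInner e m β (he.hodgeDual_kaehlerForm hcJ ho)

theorem formInner_kaehlerForm_self (he : IsConformalFrame c o x e m)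
    (hcJ : IsConformallyAlmostHermitian c J) (ho : IsComplexOrientation J o) :
    formInner e m (kaehlerForm c J x) (kaehlerForm c J x) = 2 := by
  rw [← he.formWedge_kaehlerForm hcJ ho, formWedge_self, he.pfaffian_kaehlerForm hcJ ho, mul_one]

end IsConformalFrame

theorem kaehlerSection_mem_twistorSpacePlus (hcJ : IsConformallyAlmostHermitian c J)
    (ho : IsComplexOrientation J o) (x : M) :
    kaehlerSection c J x ∈ twistorSpacePlus c o :=
  ⟨isTwoForm_kaehlerForm hcJ x, fun _ _ he β _ => he.formWedge_kaehlerForm hcJ ho β,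
    fun _ _ he => he.formInner_kaehlerForm_self hcJ ho⟩

end Manifold4

/-! ### Holomorphicity of the section -/

section Manifold4

variable {M : Type*} [TopologicalSpace M] [ChartedSpace E4 M] [IsManifold (𝓡 4) ∞ M]
  {c : ConformalMetric M} {J : AlmostComplexStructure M}
  {D : CovariantDerivative (𝓡 4) ℝ (Density (M := M) 1)}
  {nabla : CovariantDerivative (𝓡 4) E4 (TangentSpace (𝓡 4) : M → Type)}

theorem isInvertible_metric (c : ConformalMetric M) (x : M) : (c.form x).IsInvertible := by
  have hinj : Function.Injective (c.form x) := by
    rw [injective_iff_map_eq_zero]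
    intro v hv
    by_contra hne
    have h := c.pos x v hne
    rw [hv] at h
    exact lt_irrefl (0 : ℝ) h
  let f : E4 →L[ℝ] E4 →L[ℝ] ℝ := c.form x
  have hfin : Module.finrank ℝ E4 = Module.finrank ℝ (E4 →L[ℝ] ℝ) :=
    (InnerProductSpace.toDual ℝ E4).toLinearEquiv.finrank_eq
  let e : E4 ≃L[ℝ] (E4 →L[ℝ] ℝ) :=
    (LinearEquiv.ofInjectiveOfFinrankEq f.toLinearMap hinj hfin).toContinuousLinearEquiv
  exact ⟨e, rfl⟩

theorem endoOfForm_kaehlerSection (c : ConformalMetric M) (J : AlmostComplexStructure M) (x : M) :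
    endoOfForm c (kaehlerSection c J x) = J.toFun x := by
  ext1 v
  exact (isInvertible_metric c x).inverse_apply_eq.2 rfl

theorem kaehlerSectionDeriv_eq
    (nabla : CovariantDerivative (𝓡 4) E4 (TangentSpace (𝓡 4) : M → Type))
    (D : CovariantDerivative (𝓡 4) ℝ (Density (M := M) 1)) (x : M) (Z : TangentSpace (𝓡 4) x) :
    kaehlerSectionDeriv c J x Z =
      horizontalLift (bilinCov nabla D) (kaehlerSection c J x) Z +
        verticalLift (𝓡 4) (kaehlerSection c J x) (bilinCov nabla D (kaehlerForm c J) x Z) :=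
  mfderiv_form_section nabla D (mdiffForm_kaehlerForm c J x) Z

theorem bilinCov_kaehlerForm_mem_antiInvariantForms (hcJ : IsConformallyAlmostHermitian c J)
    (hnabla : IsWeylConnection c D nabla) (x : M) (Z : TangentSpace (𝓡 4) x) :
    bilinCov nabla D (kaehlerForm c J) x Z ∈ antiInvariantForms c (kaehlerSection c J x) := by
  refine ⟨isTwoForm_bilinCov nabla D (mdiffForm_kaehlerForm c J x) (isTwoForm_kaehlerForm hcJ) Z,
    fun v w => ?_⟩
  rw [endoOfForm_kaehlerSection]
  exact bilinCov_kaehlerForm_J_J hcJ hnabla Z v w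

theorem kaehlerSectionDeriv_mem_twistorTangent (hcJ : IsConformallyAlmostHermitian c J)
    (hnabla : IsWeylConnection c D nabla) (x : M) (Z : TangentSpace (𝓡 4) x) :
    kaehlerSectionDeriv c J x Z ∈ twistorTangent c D nabla (kaehlerSection c J x) := by
  rw [kaehlerSectionDeriv_eq nabla D]
  exact Submodule.add_mem_sup (LinearMap.mem_range_self _ _)
    (Submodule.mem_map_of_mem (bilinCov_kaehlerForm_mem_antiInvariantForms hcJ hnabla x Z))

theorem twistorJ_apply (c : ConformalMetric M)
    (D : CovariantDerivative (𝓡 4) ℝ (Density (M := M) 1))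
    (nabla : CovariantDerivative (𝓡 4) E4 (TangentSpace (𝓡 4) : M → Type)) (q : FormTotal M)
    {A : TangentSpace (𝓡 4) q.proj →L[ℝ] TangentSpace (𝓡 4) q.proj} (hA : endoOfForm c q = A)
    (X : TangentSpace (𝓡 4) q.proj) (β : WForm q.proj) :
    twistorJ c D nabla q (horizontalLift (bilinCov nabla D) q X + verticalLift (𝓡 4) q β) =
      horizontalLift (bilinCov nabla D) q (A X) + verticalLift (𝓡 4) q (formAct A β) := by
  subst hA
  exact splittingEnd_apply (bilinCov nabla D) q (endoOfForm c q).toLinearMap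
    (formAct (endoOfForm c q)) X β

theorem kaehlerSectionDeriv_J (hcJ : IsConformallyAlmostHermitian c J)
    (hD : IsCanonicalWeylDerivative c J D) (hnabla : IsWeylConnection c D nabla) (x : M)
    (Z : TangentSpace (𝓡 4) x) :
    kaehlerSectionDeriv c J x (J.toFun x Z) =
      twistorJ c D nabla (kaehlerSection c J x) (kaehlerSectionDeriv c J x Z) := by
  rw [kaehlerSectionDeriv_eq nabla D, kaehlerSectionDeriv_eq nabla D,
    bilinCov_kaehlerForm_J hcJ hD hnabla]
  exact (twistorJ_apply c D nabla (kaehlerSection c J x) (endoOfForm_kaehlerSection c J x) Z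
    (bilinCov nabla D (kaehlerForm c J) x Z)).symm

end Manifold4

end WeylTwistor

open WeylTwistor in
theorem theorem2 {M : Type*} [TopologicalSpace M] [ChartedSpace E4 M] [IsManifold (𝓡 4) ∞ M]
    (c : ConformalMetric M) (J : AlmostComplexStructure M)
    (hcJ : IsConformallyAlmostHermitian c J)
    (o : (x : M) → Orientation ℝ (TangentSpace (𝓡 4) x) (Fin 4))
    (ho : IsComplexOrientation J o)
    (D : CovariantDerivative (𝓡 4) ℝ (Density (M := M) 1))
    (hD : IsCanonicalWeylDerivative c J D)
    (nabla : CovariantDerivative (𝓡 4) E4 (TangentSpace (𝓡 4) : M → Type))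
    (hnabla : IsWeylConnection c D nabla) :
    ContMDiff (𝓡 4) FormModel ∞ (kaehlerSection c J) ∧
    (∀ x : M, kaehlerSection c J x ∈ twistorSpacePlus c o) ∧
    (∀ (x : M) (Z : TangentSpace (𝓡 4) x),
      bilinCov nabla D (kaehlerForm c J) x (J.toFun x Z) =
        formAct (J.toFun x) (bilinCov nabla D (kaehlerForm c J) x Z)) ∧
    (∀ (x : M) (Z : TangentSpace (𝓡 4) x),
      kaehlerSectionDeriv c J x Z ∈ twistorTangent c D nabla (kaehlerSection c J x)) ∧
    (∀ (x : M) (Z : TangentSpace (𝓡 4) x),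
      kaehlerSectionDeriv c J x (J.toFun x Z) =
        twistorJ c D nabla (kaehlerSection c J x) (kaehlerSectionDeriv c J x Z)) :=
  ⟨contMDiff_kaehlerForm c J, kaehlerSection_mem_twistorSpacePlus hcJ ho,
    fun x Z => bilinCov_kaehlerForm_J hcJ hD hnabla Z,
    kaehlerSectionDeriv_mem_twistorTangent hcJ hnabla,
    kaehlerSectionDeriv_J hcJ hD hnabla⟩
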